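/- Write $\mathbb S^{n-1}_s$ for the set of vectors $x\in\mathbb R^n$ with $\|x\|_2=1$ and at most $s$ non-zero coordinates. Let $\mathrm{sgn}(t)=+1$ for $t>0$ and $\mathrm{sgn}(t)=-1$ for $t\le 0$, applied componentwise to vectors. For $a,b\in\{\pm1\}^m$ let $d_{\mathcal H^m}(a,b)=\frac1m|\{1\le k\le m: a_k\ne b_k\}|$, and for $x,y\in\mathbb S^{n-1}$ and $\sigma\in\mathbb R$ let $$d^\sigma(x,y)=\frac1\pi\arccos\Big(\frac{\langle x,y\rangle+\sigma^2}{1+\sigma^2}\Big).$$ A map $\Phi:\mathbb S^{n-1}_s\to\{\pm1\}^m$ has the $(s,\delta,\sigma)$-RIP if $\sup_{x,y\in\mathbb S^{n-1}_s}|d_{\mathcal H^m}(\Phi x,\Phi y)-d^\sigma(x,y)|\le\delta$. **Theorem.** Let $A$ be a random $m\times n$ matrix whose rows are independent with the standard Gaussian distribution $\mathcal N(0,I_n)$, let $\sigma\in\mathbb R$, and let $\eta\sim\mathcal N(0,\sigma^2I_m)$ be independent of $A$. Let $0<\varepsilon,\delta<1$ and $\Phi^\eta_A x=\mathrm{sgn}(Ax+\eta)$.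 (a) There is an absolute constant $C>0$ such that, whenever $1\le s<n$ and $$m\ \ge\ C\,\delta^{-2}\big[\log(2/\varepsilon)+s\log(en/s)\big],$$ the map $\Phi^\eta_A$ has the $(s,\delta,\sigma)$-RIP with probability at least $1-\varepsilon$. (b) For every $\kappa\in(0,1)$ there is a constant $C_\kappa>0$, depending only on $\kappa$, such that, whenever $1\le s\le\kappa n$ and $$m\ \ge\ C_\kappa\,\delta^{-2}\big[\log(2/\varepsilon)+s\log(n/s)\big],$$ the map $\Phi^\eta_A$ has the $(s,\delta,\sigma)$-RIP with probability at least $1-\varepsilon$. -/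

import Mathlib

open MeasureTheory ProbabilityTheory

universe u

namespace OneBit

/-- The set of unit-length `s`-sparse vectors of `ℝⁿ`. -/
def sparseSphere (n s : ℕ) : Set (EuclideanSpace ℝ (Fin n)) :=
  {x | ‖x‖ = 1 ∧ {j : Fin n | x j ≠ 0}.ncard ≤ s}

/-- The Hamming cube `{±1}ᵐ` (the units of `ℤ` are exactly `1` and `-1`). -/
abbrev HammingCube (m : ℕ) : Type := Fin m → ℤˣ

/-- The normalized Hamming metric: the proportion of coordinates at which `a` and `b` differ. -/
noncomputable def hammingMetric {m : ℕ} (a b : HammingCube m) : ℝ :=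
  (1 / (m : ℝ)) * (hammingDist a b : ℝ)

/-- The sign, with value `+1` for `t > 0` and `-1` for `t ≤ 0`. -/
noncomputable def sgn (t : ℝ) : ℤˣ := if 0 < t then 1 else -1

/-- The noisy one-bit map `x ↦ sgn (A x + η)`, with `sgn` applied componentwise. -/
noncomputable def noisySignMap {m n : ℕ} (A : Matrix (Fin m) (Fin n) ℝ)
    (η : EuclideanSpace ℝ (Fin m)) (x : EuclideanSpace ℝ (Fin n)) : HammingCube m :=
  fun k => sgn (A.mulVec x.ofLp k + η k)

/-- The distorted metric `d^σ(x, y) = (1/π) arccos ((⟨x, y⟩ + σ²) / (1 + σ²))`. -/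
noncomputable def distortedDist {n : ℕ} (σ : ℝ) (x y : EuclideanSpace ℝ (Fin n)) : ℝ :=
  (1 / Real.pi) * Real.arccos ((inner ℝ x y + σ ^ 2) / (1 + σ ^ 2))

/-- The `(s, δ, σ)`-RIP: the supremum over pairs of unit `s`-sparse vectors of
`|d_H (Φ x, Φ y) - d^σ (x, y)|` is at most `δ`. -/
def HasNoisyRIP {m n : ℕ} (s : ℕ) (δ σ : ℝ) (Φ : sparseSphere n s → HammingCube m) : Prop :=
  ∀ x y : sparseSphere n s, |hammingMetric (Φ x) (Φ y) - distortedDist σ x.1 y.1| ≤ δ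

/-- `A` is a random `m × n` matrix with independent rows of law `N(0, I_n)`, and `η` is a random
vector of law `N(0, σ² I_m)`, independent of `A`. -/
structure IsGaussianModel {m n : ℕ} {Ω : Type u} [MeasurableSpace Ω] (P : Measure Ω) (σ : ℝ)
    (A : Ω → Matrix (Fin m) (Fin n) ℝ) (η : Ω → EuclideanSpace ℝ (Fin m)) : Prop where
  row_law : ∀ k : Fin m,
    HasLaw (fun ω => WithLp.toLp 2 (A ω k)) (stdGaussian (EuclideanSpace ℝ (Fin n))) P
  row_indep : iIndepFun (fun (k : Fin m) (ω : Ω) => (A ω k : Fin n → ℝ)) P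
  noise_law : HasLaw η (multivariateGaussian 0 (σ ^ 2 • (1 : Matrix (Fin m) (Fin m) ℝ))) P
  indep : IndepFun (fun (ω : Ω) (k : Fin m) (j : Fin n) => A ω k j) η P

/-- For Gaussian `A` and independent `η ~ N(0, σ² I_m)`, on whatever probability space they are
defined, the map `x ↦ sgn (A x + η)` has the `(s, δ, σ)`-RIP with probability at least `1 - ε`.
As the RIP involves an uncountable supremum, this is said through a measurable event of
probability at least `1 - ε` on which it holds (so the inner probability is bounded). -/
def NoisyRIPWithProb (m n s : ℕ) (δ σ ε : ℝ) : Prop :=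
  ∀ (Ω : Type u) [MeasurableSpace Ω] (P : Measure Ω) [IsProbabilityMeasure P]
    (A : Ω → Matrix (Fin m) (Fin n) ℝ) (η : Ω → EuclideanSpace ℝ (Fin m)),
    IsGaussianModel P σ A η →
      ∃ E : Set Ω, MeasurableSet E ∧ 1 - ε ≤ P.real E ∧
        ∀ ω ∈ E, HasNoisyRIP s δ σ (fun x : sparseSphere n s => noisySignMap (A ω) (η ω) x.1)

end OneBit

/-! The bits of `x` and `y` differ at index `k` exactly when the pair (row `k`, noise value `k`)
lies in `separatingSet x y`. The Hamming distance is thus an empirical frequency over `m` i.i.d.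
points, and the RIP is a uniform law of large numbers over these sets. Their probabilities are
explicit: the two measurements are centred Gaussians of variance `1 + σ²` and covariance `⟨x, y⟩ +
σ²`, and by rotation invariance in the plane their signs differ with probability `arccos` of the
correlation over `π` (`rowLaw_separatingSet`).

Uniformity is obtained combinatorially, so the discontinuity of the sign does no harm. For a fixed
support of size `s` the measurements depend affinely on `s` parameters, so Sauer–Shelah bounds the
number of sign patterns; the choice of support costs a factor `exp (s log (en/s))`
(`card_traces_separatingSet_le`).

A union bound over all patterns would lose a logarithm in the sample size. Instead, a Haussler-type
packing bound shows that traces separated on a proportion `16⁻ʲ` of the sample number at most `exp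
(20 K j)`, with `K = s log (en/s)`, whatever the sample size (`card_le_exp_of_separated`).
Symmetrization with a second sample reduces the deviations to signed sums, and chaining along these
packings (`card_exists_lt_abs_sum_le`) gives a tail `exp (-c m δ²)` once `m δ²` dominates `K`. For
(b), `log (n/s)` is bounded below by `log (1/κ)`, so the `e` inside the logarithm is absorbed in the
constant. -/

namespace OneBit

/-! ### Growth of the number of sign patterns. -/

section Growth

open Finset

/-- The set of indices `k` for which the point `z k` belongs to the `i`-th set of the family. -/
noncomputable def trace {Z I ι : Type*} [Fintype ι] (D : I → Set Z) (z : ι → Z) (i : I) :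
    Finset ι := by
  classical exact univ.filter fun k => z k ∈ D i

lemma mem_trace {Z I ι : Type*} [Fintype ι] {D : I → Set Z} {z : ι → Z} {i : I} {k : ι} :
    k ∈ trace D z i ↔ z k ∈ D i := by
  simp [trace]

/-- The set of all traces of the family `D` on the points `z`. -/
noncomputable def traces {Z I ι : Type*} [Fintype ι] (D : I → Set Z) (z : ι → Z) :
    Finset (Finset ι) :=
  (Set.toFinite (Set.range (trace D z))).toFinset

lemma mem_traces {Z I ι : Type*} [Fintype ι] {D : I → Set Z} {z : ι → Z} {t : Finset ι} :
    t ∈ traces D z ↔ ∃ i, trace D z i = t := by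
  simp [traces]

/-- Inserting the weights `b ^ (s - k) ≥ 1` turns the sum into part of the binomial expansion of `(1
+ 1/b) ^ N`. The parameter `b` stays free: the packing argument tunes it to each scale. -/
lemma sum_choose_le (N s : ℕ) {b : ℝ} (hb : 1 ≤ b) :
    ∑ k ∈ Iic s, (N.choose k : ℝ) ≤ b ^ s * Real.exp (N / b) := by
  have hb0 : 0 < b := by linarith
  have h1 : ∑ k ∈ Iic s, (N.choose k : ℝ) ≤
      b ^ s * ∑ k ∈ Iic s, (b⁻¹) ^ k * (N.choose k : ℝ) := by
    rw [mul_sum]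
    refine sum_le_sum fun k hk => ?_
    rw [← mul_assoc]
    refine le_mul_of_one_le_left (by positivity) ?_
    have : b ^ s * b⁻¹ ^ k = b ^ (s - k) := by
      rw [mem_Iic] at hk
      rw [inv_pow, ← div_eq_mul_inv, pow_sub₀ _ hb0.ne' hk, div_eq_mul_inv]
    rw [this]
    exact one_le_pow₀ hb
  have h2 : ∑ k ∈ Iic s, (b⁻¹) ^ k * (N.choose k : ℝ) ≤ (b⁻¹ + 1) ^ N := by
    rw [add_pow]
    have h3 : ∑ k ∈ Iic s, (b⁻¹) ^ k * (N.choose k : ℝ) ≤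
        ∑ k ∈ range (max s N + 1), (b⁻¹) ^ k * (N.choose k : ℝ) := by
      refine sum_le_sum_of_subset_of_nonneg (fun k hk => ?_) fun _ _ _ => by positivity
      simp at hk ⊢; omega
    refine h3.trans (le_of_eq ?_)
    symm
    simp only [one_pow, mul_one]
    refine sum_subset (fun k hk => ?_) fun k _ hk => ?_
    · simp at hk ⊢; omega
    · simp at hk
      simp [Nat.choose_eq_zero_of_lt (show N < k by omega)]
  have h4 : (b⁻¹ + 1) ^ N ≤ Real.exp (N / b) := by
    calc (b⁻¹ + 1) ^ N ≤ (Real.exp b⁻¹) ^ N := by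
          gcongr; exact Real.add_one_le_exp _
      _ = Real.exp (N / b) := by rw [← Real.exp_nat_mul, div_eq_mul_inv]
  calc _ ≤ _ := h1
    _ ≤ _ := by gcongr; exact h2.trans h4

lemma choose_le_exp {n s : ℕ} (hs : 1 ≤ s) (hsn : s ≤ n) :
    (n.choose s : ℝ) ≤ Real.exp (s * Real.log (Real.exp 1 * n / s)) := by
  have hs0 : (0 : ℝ) < s := by exact_mod_cast hs
  have hn0 : (0 : ℝ) < n := by exact_mod_cast (by omega : 0 < n)
  have hb : (1 : ℝ) ≤ n / s := by rw [le_div_iff₀ hs0]; simpa using hsn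
  have h := sum_choose_le n s hb
  have h1 : (n.choose s : ℝ) ≤ ∑ k ∈ Iic s, (n.choose k : ℝ) :=
    single_le_sum (f := fun k => (n.choose k : ℝ)) (fun _ _ => by positivity) (by simp)
  refine h1.trans (h.trans (le_of_eq ?_))
  rw [mul_div_assoc, Real.log_mul (by positivity) (by positivity), Real.log_exp, mul_add, mul_one,
    Real.exp_add, mul_comm, Real.exp_nat_mul, Real.exp_log (by positivity)]
  congr 2
  field_simp

/-- A family of positivity sets of an affine space of functions shatters no set with more elements
than the dimension. -/
lemma card_le_finrank_of_shatters {ι V : Type*} [DecidableEq ι] [AddCommGroup V] [Module ℝ V]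
    [FiniteDimensional ℝ V] (L : V →ₗ[ℝ] ι → ℝ) (g : ι → ℝ) {𝒜 : Finset (Finset ι)}
    (h𝒜 : ∀ u ∈ 𝒜, ∃ v, ∀ k, k ∈ u ↔ 0 < L v k + g k) {S : Finset ι} (hS : 𝒜.Shatters S) :
    #S ≤ Module.finrank ℝ V := by
  by_contra! hlt
  set R : V →ₗ[ℝ] S → ℝ := (LinearMap.funLeft ℝ ℝ (Subtype.val : S → ι)).comp L
  -- If `S` has more elements than the dimension, the restriction to `S` is not onto, so a nonzero
  -- functional with coefficients `c` kills its range.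
  have hR : LinearMap.range R < ⊤ := by
    refine lt_top_iff_ne_top.2 fun h => ?_
    have h1 := LinearMap.finrank_range_le R
    rw [h, finrank_top] at h1
    simp at h1
    omega
  obtain ⟨f, hf0, hf⟩ := Submodule.exists_le_ker_of_lt_top _ hR
  set c : S → ℝ := fun k => f (Pi.single k 1)
  have hfc : ∀ w : S → ℝ, f w = ∑ k, c k * w k := by
    intro w
    conv_lhs => rw [← univ_sum_single w, map_sum]
    refine sum_congr rfl fun k _ => ?_
    have : (Pi.single k (w k) : S → ℝ) = w k • Pi.single k 1 := by
      rw [← Pi.single_smul]; simp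
    rw [this, map_smul, smul_eq_mul, mul_comm]
  have hc : ∃ k, c k ≠ 0 := by
    by_contra! h
    exact hf0 (LinearMap.ext fun w => by simp [hfc, h])
  have hconst : ∀ v, ∑ k : S, c k * (L v k + g k) = ∑ k : S, c k * g k := by
    intro v
    have h0 : f (R v) = 0 := hf ⟨v, rfl⟩
    rw [hfc] at h0
    simp_rw [mul_add, sum_add_distrib]
    rw [show ∑ k : S, c k * L v k = 0 from h0, zero_add]
  have hpat : ∀ p : S → Prop, ∃ v, ∀ k : S, p k ↔ 0 < L v k + g k := by
    classical
    intro p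
    obtain ⟨u, hu, huS⟩ := hS (t := (univ.filter p).map (Function.Embedding.subtype _))
      (fun k hk => by simp at hk; exact hk.1)
    obtain ⟨v, hv⟩ := h𝒜 u hu
    refine ⟨v, fun k => ?_⟩
    rw [← hv k]
    have := congrArg (fun t => (k : ι) ∈ t) huS
    simp at this
    exact this.symm
  -- The `c`-weighted sum of the affine values does not depend on `v`. The sign pattern of `c` makes
  -- it nonnegative, the opposite one nonpositive, and any nonzero `c k` makes one of the two
  -- strict.
  obtain ⟨v₁, hv₁⟩ := hpat fun k => 0 < c k
  obtain ⟨v₂, hv₂⟩ := hpat fun k => c k < 0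
  have t₁ : ∀ k : S, 0 ≤ c k * (L v₁ k + g k) := fun k => by
    by_cases h : 0 < c k
    · exact (mul_pos h ((hv₁ k).1 h)).le
    · exact mul_nonneg_of_nonpos_of_nonpos (not_lt.1 h) (not_lt.1 (mt (hv₁ k).2 h))
  have t₂ : ∀ k : S, c k * (L v₂ k + g k) ≤ 0 := fun k => by
    by_cases h : c k < 0
    · exact (mul_neg_of_neg_of_pos h ((hv₂ k).1 h)).le
    · exact mul_nonpos_of_nonneg_of_nonpos (not_lt.1 h) (not_lt.1 (mt (hv₂ k).2 h))
  have s₁ : 0 ≤ ∑ k : S, c k * g k := by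
    rw [← hconst v₁]; exact sum_nonneg fun k _ => t₁ k
  have s₂ : ∑ k : S, c k * g k ≤ 0 := by
    rw [← hconst v₂]; exact sum_nonpos fun k _ => t₂ k
  obtain ⟨k, hk⟩ := hc
  rcases lt_or_gt_of_ne hk with hk | hk
  · have := sum_lt_sum (fun k (_ : k ∈ univ) => t₂ k)
      ⟨k, mem_univ k, mul_neg_of_neg_of_pos hk ((hv₂ k).1 hk)⟩
    rw [hconst, sum_const_zero] at this
    linarith
  · have := sum_lt_sum (fun k (_ : k ∈ univ) => t₁ k)
      ⟨k, mem_univ k, mul_pos hk ((hv₁ k).1 hk)⟩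
    rw [hconst, sum_const_zero] at this
    linarith

/-- Sauer–Shelah, with the VC dimension bounded by the dimension of the parameter space. -/
lemma card_le_of_affine {ι V : Type*} [Fintype ι] [AddCommGroup V] [Module ℝ V]
    [FiniteDimensional ℝ V] (L : V →ₗ[ℝ] ι → ℝ) (g : ι → ℝ) {𝒜 : Finset (Finset ι)}
    (h𝒜 : ∀ u ∈ 𝒜, ∃ v, ∀ k, k ∈ u ↔ 0 < L v k + g k) {b : ℝ} (hb : 1 ≤ b) :
    (#𝒜 : ℝ) ≤ b ^ Module.finrank ℝ V * Real.exp (Fintype.card ι / b) := by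
  classical
  have h1 : #𝒜 ≤ ∑ k ∈ Iic 𝒜.vcDim, (Fintype.card ι).choose k :=
    (card_le_card_shatterer 𝒜).trans card_shatterer_le_sum_vcDim
  have h2 : 𝒜.vcDim ≤ Module.finrank ℝ V :=
    Finset.sup_le fun S hS => card_le_finrank_of_shatters L g h𝒜 (mem_shatterer.1 hS)
  have h3 : #𝒜 ≤ ∑ k ∈ Iic (Module.finrank ℝ V), (Fintype.card ι).choose k :=
    h1.trans (sum_le_sum_of_subset (Iic_subset_Iic.2 h2))
  calc (#𝒜 : ℝ) ≤ ∑ k ∈ Iic (Module.finrank ℝ V), ((Fintype.card ι).choose k : ℝ) := by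
        exact_mod_cast h3
    _ ≤ _ := sum_choose_le _ _ hb

/-- The pairs `(a, g)` of a row and a noise value for which the bit of `x` is `+1`. -/
def positiveSet {n : ℕ} (x : EuclideanSpace ℝ (Fin n)) : Set ((Fin n → ℝ) × ℝ) :=
  {z | 0 < z.1 ⬝ᵥ x.ofLp + z.2}

/-- The pairs `(a, g)` of a row and a noise value which separate `x` and `y`. -/
def separatingSet {n : ℕ} (x y : EuclideanSpace ℝ (Fin n)) : Set ((Fin n → ℝ) × ℝ) :=
  symmDiff (positiveSet x) (positiveSet y)

lemma card_traces_positiveSet_le {n s N : ℕ} (hs : 1 ≤ s) (hsn : s ≤ n)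
    (z : Fin N → (Fin n → ℝ) × ℝ) {b : ℝ} (hb : 1 ≤ b) :
    (#(traces (fun x : sparseSphere n s => positiveSet x.1) z) : ℝ) ≤
      Real.exp (s * Real.log (Real.exp 1 * n / s)) * (b ^ s * Real.exp (N / b)) := by
  classical
  set 𝒯 := traces (fun x : sparseSphere n s => positiveSet x.1) z
  let 𝒜 : Finset (Fin n) → Finset (Finset (Fin N)) := fun T =>
    univ.filter fun u => ∃ v : T → ℝ, ∀ k, k ∈ u ↔ 0 < ∑ j : T, (z k).1 j * v j + (z k).2
  have hsub : 𝒯 ⊆ (powersetCard s univ).biUnion 𝒜 := by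
    intro t ht
    obtain ⟨⟨x, hx1, hx2⟩, rfl⟩ := mem_traces.1 ht
    have hcard : #(univ.filter fun j => x j ≠ 0) ≤ s := by
      rw [Set.ncard_eq_toFinset_card'] at hx2
      simpa using hx2
    -- Supports are padded to size exactly `s`, so that only `n.choose s` of them need counting.
    obtain ⟨T, hT1, hT2⟩ := exists_superset_card_eq hcard (by simpa using hsn)
    refine mem_biUnion.2 ⟨T, by simpa using hT2, ?_⟩
    refine mem_filter.2 ⟨mem_univ _, fun j => x j, fun k => ?_⟩
    rw [mem_trace]
    have : ∑ j : T, (z k).1 j * x j = (z k).1 ⬝ᵥ x.ofLp := by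
      rw [sum_coe_sort T fun j => (z k).1 j * x j]
      refine sum_subset (subset_univ _) fun j _ hj => ?_
      have : x j = 0 := by
        by_contra h
        exact hj (hT1 (by simpa using h))
      simp [this]
    simp only [positiveSet, Set.mem_ofPred_eq, this]
  have hA : ∀ T ∈ powersetCard s (univ : Finset (Fin n)),
      (#(𝒜 T) : ℝ) ≤ b ^ s * Real.exp (N / b) := by
    intro T hT
    have hT' : #T = s := by simpa using hT
    let L : (T → ℝ) →ₗ[ℝ] Fin N → ℝ :=
      LinearMap.pi fun k => ∑ j : T, (z k).1 j • LinearMap.proj j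
    have := card_le_of_affine L (fun k => (z k).2) (𝒜 := 𝒜 T) (fun u hu => by
      obtain ⟨v, hv⟩ := (mem_filter.1 hu).2
      exact ⟨v, fun k => by simpa [L, LinearMap.sum_apply] using hv k⟩) hb
    simpa [hT'] using this
  calc (#𝒯 : ℝ) ≤ #((powersetCard s univ).biUnion 𝒜) := by exact_mod_cast card_le_card hsub
    _ ≤ ∑ T ∈ powersetCard s (univ : Finset (Fin n)), (#(𝒜 T) : ℝ) := by
        exact_mod_cast card_biUnion_le
    _ ≤ ∑ T ∈ powersetCard s (univ : Finset (Fin n)), b ^ s * Real.exp (N / b) := sum_le_sum hA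
    _ = (n.choose s : ℝ) * (b ^ s * Real.exp (N / b)) := by simp
    _ ≤ _ := by
        gcongr
        exact choose_le_exp hs hsn

/-- A trace of a separating set is the symmetric difference of two traces of positive sets, hence
the square. -/
lemma card_traces_separatingSet_le {n s N : ℕ} (hs : 1 ≤ s) (hsn : s ≤ n)
    (z : Fin N → (Fin n → ℝ) × ℝ) {b : ℝ} (hb : 1 ≤ b) :
    (#(traces (fun p : sparseSphere n s × sparseSphere n s =>
        separatingSet p.1.1 p.2.1) z) : ℝ) ≤
      (Real.exp (s * Real.log (Real.exp 1 * n / s)) * (b ^ s * Real.exp (N / b))) ^ 2 := by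
  classical
  set 𝒯 := traces (fun x : sparseSphere n s => positiveSet x.1) z with h𝒯
  have hsub : traces (fun p : sparseSphere n s × sparseSphere n s =>
      separatingSet p.1.1 p.2.1) z ⊆ (𝒯 ×ˢ 𝒯).image fun p => symmDiff p.1 p.2 := by
    intro t ht
    obtain ⟨⟨x, y⟩, rfl⟩ := mem_traces.1 ht
    refine mem_image.2 ⟨(trace (fun x : sparseSphere n s => positiveSet x.1) z x,
        trace (fun x : sparseSphere n s => positiveSet x.1) z y),
      mem_product.2 ⟨mem_traces.2 ⟨x, rfl⟩, mem_traces.2 ⟨y, rfl⟩⟩, ?_⟩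
    ext k
    simp [mem_symmDiff, mem_trace, separatingSet, Set.mem_symmDiff]
  calc (#(traces _ z) : ℝ) ≤ #((𝒯 ×ˢ 𝒯).image fun p => symmDiff p.1 p.2) := by
        exact_mod_cast card_le_card hsub
    _ ≤ #(𝒯 ×ˢ 𝒯) := by exact_mod_cast card_image_le
    _ = (#𝒯 : ℝ) ^ 2 := by rw [card_product]; push_cast; ring
    _ ≤ _ := by
        gcongr
        exact card_traces_positiveSet_le hs hsn z hb

end Growth

/-! ### Packing numbers that do not depend on the sample size. -/

section Packing

open Finset

/-- If the members of a family of subsets of `ι` differ pairwise on a proportion `r` of all points,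
then they can be told apart by their restrictions to `N` points, where `N` is of order
`r⁻¹ log #P`. -/
lemma exists_injOn_of_separated {ι : Type*} [Fintype ι] [DecidableEq ι] [Nonempty ι]
    {P : Finset (Finset ι)} {r : ℝ}
    (hP : ∀ s ∈ P, ∀ t ∈ P, s ≠ t → r * Fintype.card ι < #(symmDiff s t)) {N : ℕ}
    (hne : P.Nonempty) (hN : (#P : ℝ) ^ 2 * Real.exp (-(r * N)) ≤ 1) :
    ∃ p : Fin N → ι, Set.InjOn (fun s : Finset ι => univ.filter fun k => p k ∈ s) P := by
  set c := Fintype.card ι with hc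
  have hc0 : 0 < c := Fintype.card_pos
  -- The probabilistic method by counting: `bad q` consists of the `N`-point samples that fail to
  -- tell the two members of `q` apart.
  let bad : Finset ι × Finset ι → Finset (Fin N → ι) := fun q =>
    Fintype.piFinset fun _ => (symmDiff q.1 q.2)ᶜ
  have hbad : ∀ q ∈ P.offDiag, (#(bad q) : ℝ) ≤ Real.exp (-(r * N)) * (c : ℝ) ^ N := by
    intro q hq
    rw [mem_offDiag] at hq
    have h1 := hP q.1 hq.1 q.2 hq.2.1 hq.2.2
    have h2 : #((symmDiff q.1 q.2)ᶜ) + #(symmDiff q.1 q.2) = c := by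
      rw [add_comm]; exact card_add_card_compl _
    have h2' : (#((symmDiff q.1 q.2)ᶜ) : ℝ) + #(symmDiff q.1 q.2) = c := by exact_mod_cast h2
    have h3 : (#((symmDiff q.1 q.2)ᶜ) : ℝ) ≤ Real.exp (-r) * c := by
      have := Real.add_one_le_exp (-r)
      have hc' : (0 : ℝ) < c := by exact_mod_cast hc0
      nlinarith
    have h4 : #(bad q) = #((symmDiff q.1 q.2)ᶜ) ^ N := by simp [bad, Fintype.card_piFinset]
    rw [h4]
    push_cast
    calc (#((symmDiff q.1 q.2)ᶜ) : ℝ) ^ N ≤ (Real.exp (-r) * c) ^ N := by gcongr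
      _ = _ := by rw [mul_pow, ← Real.exp_nat_mul]; ring_nf
  have hcard : #(P.offDiag.biUnion bad) < Fintype.card (Fin N → ι) := by
    have h5 : (#(P.offDiag.biUnion bad) : ℝ) ≤
        (#P.offDiag : ℝ) * (Real.exp (-(r * N)) * (c : ℝ) ^ N) := by
      calc (#(P.offDiag.biUnion bad) : ℝ) ≤ ∑ q ∈ P.offDiag, (#(bad q) : ℝ) := by
            exact_mod_cast card_biUnion_le
        _ ≤ ∑ q ∈ P.offDiag, (Real.exp (-(r * N)) * (c : ℝ) ^ N) := sum_le_sum hbad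
        _ = _ := by simp
    -- Leaving out the diagonal makes this strict, so the bad samples do not exhaust all samples
    -- even when `hN` is an equality.
    have h6 : (#P.offDiag : ℝ) < (#P : ℝ) ^ 2 := by
      have h7 : #P.offDiag < #P ^ 2 := by
        have h8 := hne.card_pos
        rw [offDiag_card, pow_two]
        have : 0 < #P * #P := by positivity
        omega
      exact_mod_cast h7
    have hcN : (0 : ℝ) < (c : ℝ) ^ N := by positivity
    have h9 : (#(P.offDiag.biUnion bad) : ℝ) < (c : ℝ) ^ N := by
      calc _ ≤ _ := h5
        _ < (#P : ℝ) ^ 2 * (Real.exp (-(r * N)) * (c : ℝ) ^ N) := by gcongr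
        _ = ((#P : ℝ) ^ 2 * Real.exp (-(r * N))) * (c : ℝ) ^ N := by ring
        _ ≤ 1 * (c : ℝ) ^ N := by gcongr
        _ = _ := one_mul _
    rw [Fintype.card_fun, Fintype.card_fin]
    exact_mod_cast h9
  obtain ⟨p, hp⟩ : ∃ p, p ∉ P.offDiag.biUnion bad := by
    by_contra! h
    have := eq_univ_iff_forall.2 h
    rw [this, card_univ] at hcard
    exact lt_irrefl _ hcard
  refine ⟨p, fun s hs t ht hst => ?_⟩
  by_contra hne'
  refine hp (mem_biUnion.2 ⟨(s, t), mem_offDiag.2 ⟨hs, ht, hne'⟩, ?_⟩)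
  simp only [bad, Fintype.mem_piFinset]
  intro k
  have := congrArg (fun u => k ∈ u) hst
  simp at this
  simp [this]

/-- A separated family injects into its traces on about `16 ^ j · log #P` points, and the growth
bound there is an inequality for `log #P` in terms of itself. -/
lemma card_le_exp_of_separated {Z I ι : Type*} [Fintype ι] [DecidableEq ι] [Nonempty ι]
    {D : I → Set Z} {K : ℝ} {s : ℕ} (hK : 1 ≤ K) (hsK : (s : ℝ) ≤ K)
    (hD : ∀ (N : ℕ) (z : Fin N → Z) (b : ℝ), 1 ≤ b →
      (#(traces D z) : ℝ) ≤ (Real.exp K * (b ^ s * Real.exp (N / b))) ^ 2)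
    (z : ι → Z) {j : ℕ} (hj : 1 ≤ j) {P : Finset (Finset ι)} (hPz : P ⊆ traces D z)
    (hP : ∀ s ∈ P, ∀ t ∈ P, s ≠ t → (16 ^ j : ℝ)⁻¹ * Fintype.card ι < #(symmDiff s t)) :
    (#P : ℝ) ≤ Real.exp (20 * K * j) := by
  rcases P.eq_empty_or_nonempty with rfl | hne
  · simp; positivity
  have hP1 : (1 : ℝ) ≤ #P := by exact_mod_cast hne.card_pos
  have hP0 : (0 : ℝ) < #P := by linarith
  set L := Real.log #P with hL
  have hL0 : 0 ≤ L := Real.log_nonneg hP1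
  have hexpL : Real.exp L = #P := Real.exp_log hP0
  set N := ⌊2 * L * 16 ^ j⌋₊ + 1 with hN
  have hN1 : 2 * L * 16 ^ j ≤ N := by
    rw [hN]; push_cast; exact (Nat.lt_floor_add_one _).le
  have hN2 : (N : ℝ) ≤ 2 * L * 16 ^ j + 1 := by
    rw [hN]; push_cast
    have := Nat.floor_le (show 0 ≤ 2 * L * 16 ^ j by positivity)
    linarith
  obtain ⟨p, hp⟩ := exists_injOn_of_separated (N := N) hP hne (by
    rw [← hexpL, ← Real.exp_nat_mul, ← Real.exp_add]
    refine Real.exp_le_one_iff.2 ?_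
    have : (2 * L) ≤ (16 ^ j : ℝ)⁻¹ * N := by
      rw [inv_mul_eq_div, le_div_iff₀ (by positivity)]; exact hN1
    push_cast; linarith)
  have hcard : #P ≤ #(traces D (z ∘ p)) := by
    refine card_le_card_of_injOn _ (fun t ht => ?_) hp
    obtain ⟨i, rfl⟩ := mem_traces.1 (hPz ht)
    refine mem_traces.2 ⟨i, ?_⟩
    ext k
    simp [mem_trace]
  -- With `b = 16 ^ (j + 1)` the term `2 * (N / b)` is at most `L / 4 + 1 / 8`, which is absorbed on
  -- the left.
  have hb : (1 : ℝ) ≤ 16 ^ (j + 1) := one_le_pow₀ (by norm_num)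
  have h1 : (#P : ℝ) ≤ _ := (by exact_mod_cast hcard : (#P : ℝ) ≤ #(traces D (z ∘ p))).trans
    (hD N (z ∘ p) (16 ^ (j + 1)) hb)
  have h2 := Real.log_le_log hP0 h1
  rw [← hL, Real.log_pow, Real.log_mul (by positivity) (by positivity), Real.log_exp,
    Real.log_mul (by positivity) (by positivity), Real.log_exp, Real.log_pow, Real.log_pow] at h2
  have h16 : Real.log 16 ≤ 3 := by
    rw [show (16 : ℝ) = 2 ^ 4 by norm_num, Real.log_pow]
    have := Real.log_two_lt_d9
    push_cast; linarith
  have hNb : (N : ℝ) / 16 ^ (j + 1) ≤ L / 8 + 1 / 16 := by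
    rw [div_le_iff₀ (by positivity), pow_succ]
    have : (1 : ℝ) ≤ 16 ^ j := one_le_pow₀ (by norm_num)
    nlinarith
  have hj' : (1 : ℝ) ≤ j := by exact_mod_cast hj
  have h3 : (s : ℝ) * ((j + 1 : ℕ) * Real.log 16) ≤ K * ((j + 1) * 3) := by
    push_cast
    have := Real.log_nonneg (show (1 : ℝ) ≤ 16 by norm_num)
    gcongr
  have hKj : K ≤ K * j := le_mul_of_one_le_right (by linarith) hj'
  have h4 : L ≤ 20 * K * j := by
    push_cast at h2 h3
    nlinarith
  calc (#P : ℝ) = Real.exp L := hexpL.symm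
    _ ≤ _ := Real.exp_le_exp.2 h4

/-- A separated subfamily of maximal cardinality is a net, since an uncovered member could be added
to it. -/
lemma exists_maximal_separated {ι : Type*} [DecidableEq ι] (𝒯 : Finset (Finset ι)) {r : ℝ}
    (hr : 0 ≤ r) : ∃ P ⊆ 𝒯, (∀ s ∈ P, ∀ t ∈ P, s ≠ t → r < #(symmDiff s t)) ∧
      ∀ t ∈ 𝒯, ∃ s ∈ P, (#(symmDiff t s) : ℝ) ≤ r := by
  classical
  let S := 𝒯.powerset.filter fun P => ∀ s ∈ P, ∀ t ∈ P, s ≠ t → r < (#(symmDiff s t) : ℝ)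
  obtain ⟨P, hPS, hmax⟩ := exists_max_image S card ⟨∅, by simp [S]⟩
  obtain ⟨hP1, hP2⟩ := mem_filter.1 hPS
  rw [mem_powerset] at hP1
  refine ⟨P, hP1, hP2, fun t ht => ?_⟩
  by_contra! h
  have htP : t ∉ P := fun htP => by
    have := h t htP
    simp at this; linarith
  have hins : insert t P ∈ S := by
    refine mem_filter.2 ⟨mem_powerset.2 (insert_subset ht hP1), ?_⟩
    intro a ha b hb hab
    rcases mem_insert.1 ha with rfl | ha' <;> rcases mem_insert.1 hb with rfl | hb'
    · exact absurd rfl hab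
    · exact h b hb'
    · rw [symmDiff_comm]; exact h a ha'
    · exact hP2 a ha' b hb' hab
  have := hmax _ hins
  rw [card_insert_of_notMem htP] at this
  omega

end Packing

/-! ### Hoeffding's inequality for random signs, by counting. -/

section Rademacher

open Finset

/-- The sign attached to a swap: `-1` if the swap takes place and `1` if not. -/
def swapSign (b : Bool) : ℝ := bif b then -1 else 1

/-- Chernoff's method with `cosh x ≤ exp (x² / 2)`; `τ = l / v` minimizes the exponent. -/
lemma card_lt_sum_swapSign_le {m : ℕ} (c : Fin m → ℝ) {v l : ℝ} (hv : 0 < v)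
    (hc : ∑ k, c k ^ 2 ≤ v) (hl : 0 ≤ l) :
    (#(univ.filter fun e : Fin m → Bool => l < ∑ k, swapSign (e k) * c k) : ℝ) ≤
      2 ^ m * Real.exp (-(l ^ 2 / (2 * v))) := by
  set τ := l / v with hτ
  have hτ0 : 0 ≤ τ := by positivity
  have h1 : (#(univ.filter fun e : Fin m → Bool => l < ∑ k, swapSign (e k) * c k) : ℝ) ≤
      ∑ e : Fin m → Bool, Real.exp (-(τ * l)) * ∏ k, Real.exp (τ * (swapSign (e k) * c k)) := by
    rw [← sum_boole]
    refine sum_le_sum fun e _ => ?_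
    rw [← Real.exp_sum, ← Real.exp_add, ← mul_sum]
    split_ifs with h
    · refine Real.one_le_exp ?_
      nlinarith
    · positivity
  have h2 : ∑ e : Fin m → Bool, ∏ k, Real.exp (τ * (swapSign (e k) * c k)) =
      ∏ k, (2 * Real.cosh (τ * c k)) := by
    rw [← Fintype.piFinset_univ, ← prod_univ_sum (fun _ => (univ : Finset Bool))
      (fun k b => Real.exp (τ * (swapSign b * c k)))]
    refine prod_congr rfl fun k _ => ?_
    rw [Real.cosh_eq]
    simp [swapSign]
    ring
  have h3 : ∏ k, (2 * Real.cosh (τ * c k)) ≤ 2 ^ m * Real.exp (τ ^ 2 * v / 2) := by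
    rw [prod_mul_distrib]
    simp only [prod_const, card_univ, Fintype.card_fin]
    gcongr
    calc ∏ k, Real.cosh (τ * c k) ≤ ∏ k, Real.exp ((τ * c k) ^ 2 / 2) :=
          prod_le_prod (fun k _ => (Real.cosh_pos _).le) fun k _ => Real.cosh_le_exp_half_sq _
      _ = Real.exp (τ ^ 2 * (∑ k, c k ^ 2) / 2) := by
          rw [← Real.exp_sum, mul_sum, sum_div]
          congr 1
          exact sum_congr rfl fun k _ => by ring
      _ ≤ _ := by gcongr
  rw [← mul_sum, h2] at h1
  calc _ ≤ _ := h1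
    _ ≤ Real.exp (-(τ * l)) * (2 ^ m * Real.exp (τ ^ 2 * v / 2)) := by gcongr
    _ = 2 ^ m * Real.exp (-(τ * l) + τ ^ 2 * v / 2) := by rw [Real.exp_add]; ring
    _ = _ := by
        congr 2
        rw [hτ]; field_simp; ring

lemma card_lt_abs_sum_swapSign_le {m : ℕ} (c : Fin m → ℝ) {v l : ℝ} (hv : 0 < v)
    (hc : ∑ k, c k ^ 2 ≤ v) (hl : 0 ≤ l) :
    (#(univ.filter fun e : Fin m → Bool => l < |∑ k, swapSign (e k) * c k|) : ℝ) ≤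
      2 ^ m * (2 * Real.exp (-(l ^ 2 / (2 * v)))) := by
  classical
  have h1 := card_lt_sum_swapSign_le c hv hc hl
  have h2 := card_lt_sum_swapSign_le (fun k => -c k) hv (by simpa using hc) hl
  have h3 : (univ.filter fun e : Fin m → Bool => l < |∑ k, swapSign (e k) * c k|) ⊆
      (univ.filter fun e : Fin m → Bool => l < ∑ k, swapSign (e k) * c k) ∪
      (univ.filter fun e : Fin m → Bool => l < ∑ k, swapSign (e k) * -c k) := by
    intro e he
    simp only [mem_filter, mem_union, mem_univ, true_and, mul_neg, sum_neg_distrib] at he ⊢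
    exact lt_abs.1 he
  have h4 := (card_le_card h3).trans (card_union_le _ _)
  have h5 : (#(univ.filter fun e : Fin m → Bool => l < |∑ k, swapSign (e k) * c k|) : ℝ) ≤
      #(univ.filter fun e : Fin m → Bool => l < ∑ k, swapSign (e k) * c k) +
      #(univ.filter fun e : Fin m → Bool => l < ∑ k, swapSign (e k) * -c k) := by
    exact_mod_cast h4
  linarith

end Rademacher

/-! ### Chaining over the traces. -/

section Chaining

open Finset

/-- The difference of the indicators of `t` at the two copies of each index. -/
noncomputable def pairDiff {m : ℕ} (t : Finset (Fin m ⊕ Fin m)) (k : Fin m) : ℝ :=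
  (if Sum.inl k ∈ t then 1 else 0) - (if Sum.inr k ∈ t then 1 else 0)

lemma sum_sq_pairDiff_sub_le {m : ℕ} (t u : Finset (Fin m ⊕ Fin m)) :
    ∑ k, (pairDiff t k - pairDiff u k) ^ 2 ≤ 2 * #(symmDiff t u) := by
  have h : (#(symmDiff t u) : ℝ) =
      ∑ k : Fin m, ((if Sum.inl k ∈ symmDiff t u then 1 else 0) +
        (if Sum.inr k ∈ symmDiff t u then 1 else 0) : ℝ) := by
    rw [sum_add_distrib, ← Fintype.sum_sum_type (fun k => if k ∈ symmDiff t u then (1 : ℝ) else 0)]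
    simp
  rw [h, mul_sum]
  refine sum_le_sum fun k _ => ?_
  simp only [pairDiff, mem_symmDiff]
  by_cases h1 : Sum.inl k ∈ t <;> by_cases h2 : Sum.inr k ∈ t <;>
    by_cases h3 : Sum.inl k ∈ u <;> by_cases h4 : Sum.inr k ∈ u <;> simp [h1, h2, h3, h4] <;>
    norm_num

lemma sum_two_exp_le {M : ℝ} (hM : 1 ≤ M) (J : ℕ) :
    ∑ j ∈ range J, 2 * Real.exp (-(M * (j + 1))) ≤ 4 * Real.exp (-M) := by
  set q := Real.exp (-M) with hq
  have hq0 : 0 < q := Real.exp_pos _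
  have hq1 : q ≤ 1 / 2 := by
    rw [hq, Real.exp_neg, one_div]
    refine inv_anti₀ (by norm_num) ?_
    have := Real.add_one_le_exp M
    linarith
  have hterm : ∀ j : ℕ, 2 * Real.exp (-(M * (j + 1))) = 2 * q * q ^ j := by
    intro j
    rw [hq, mul_assoc, ← pow_succ', ← Real.exp_nat_mul]
    congr 2
    push_cast; ring
  simp_rw [hterm, ← mul_sum]
  have h := geom_sum_mul_neg q J
  have h2 : ∑ j ∈ range J, q ^ j ≤ 2 := by
    have h3 : (∑ j ∈ range J, q ^ j) * (1 - q) ≤ 1 := by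
      rw [h]; have := pow_pos hq0 J; linarith
    have h4 : 0 ≤ ∑ j ∈ range J, q ^ j := sum_nonneg fun _ _ => by positivity
    nlinarith
  nlinarith

/-- The chaining bound for the proportion of sign vectors for which the signed sum of some member
of the family `𝒯` is large, in terms of the packing numbers of `𝒯`. -/
lemma card_exists_lt_abs_sum_le {m : ℕ} (hm : 1 ≤ m) (𝒯 : Finset (Finset (Fin m ⊕ Fin m)))
    {K d : ℝ} (hK : 1 ≤ K) (hd : 0 < d) (hKd : 20 * K ≤ m * d ^ 2 / 64)
    (hpack : ∀ j : ℕ, 1 ≤ j → ∀ P ⊆ 𝒯,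
      (∀ s ∈ P, ∀ t ∈ P, s ≠ t → (16 ^ j : ℝ)⁻¹ * (2 * m) < #(symmDiff s t)) →
      (#P : ℝ) ≤ Real.exp (20 * K * j)) :
    (#(univ.filter fun e : Fin m → Bool =>
      ∃ t ∈ 𝒯, m * d < |∑ k, swapSign (e k) * pairDiff t k|) : ℝ) ≤
      2 ^ m * (4 * Real.exp (-(m * d ^ 2 / 64))) := by
  classical
  have hm0 : (0 : ℝ) < m := by exact_mod_cast hm
  set M := m * d ^ 2 / 64 with hM
  choose net hnet_sub hnet_sep hnet_cover using fun j : ℕ =>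
    exists_maximal_separated 𝒯 (show (0 : ℝ) ≤ (16 ^ j : ℝ)⁻¹ * (2 * m) by positivity)
  -- The chain starts at `∅`, which is within `2 * m` of every trace and has signed sum zero.
  let T : ℕ → Finset (Finset (Fin m ⊕ Fin m)) := fun j => if j = 0 then {∅} else net j
  have hT0 : T 0 = {∅} := rfl
  have hTcover : ∀ j, ∀ t ∈ 𝒯, ∃ u ∈ T j, (#(symmDiff t u) : ℝ) ≤ (16 ^ j : ℝ)⁻¹ * (2 * m) := by
    intro j t ht
    cases j with
    | zero =>
      refine ⟨∅, by simp [hT0], ?_⟩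
      have : #t ≤ 2 * m := by
        refine (card_le_univ t).trans ?_
        simp [two_mul]
      have h' : symmDiff t ∅ = t := symmDiff_bot t
      rw [h']
      simpa using (by exact_mod_cast this : (#t : ℝ) ≤ 2 * m)
    | succ j => exact hnet_cover (j + 1) t ht
  have hlink : ∀ j, ∀ t : Finset (Fin m ⊕ Fin m), ∃ u, t ∈ 𝒯 →
      u ∈ T j ∧ (#(symmDiff t u) : ℝ) ≤ (16 ^ j : ℝ)⁻¹ * (2 * m) := by
    intro j t
    by_cases ht : t ∈ 𝒯
    · obtain ⟨u, hu⟩ := hTcover j t ht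
      exact ⟨u, fun _ => hu⟩
    · exact ⟨∅, fun h => absurd h ht⟩
  choose prj hprj using hlink
  -- The thresholds `m d / 2 ^ (j + 1)` add up to at most `m d`, while the squared length of a link
  -- is at most `4 m / 16 ^ j`. The Hoeffding exponent is therefore `m d² 4 ^ j / 32 = 2 M 4 ^ j`.
  let badLink : ℕ → Finset (Fin m ⊕ Fin m) → Finset (Fin m → Bool) := fun j t =>
    univ.filter fun e => m * d * (2 ^ (j + 1) : ℝ)⁻¹ <
      |∑ k, swapSign (e k) * (pairDiff t k - pairDiff (prj j t) k)|
  have hbadLink : ∀ j, ∀ t ∈ T (j + 1),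
      (#(badLink j t) : ℝ) ≤ 2 ^ m * (2 * Real.exp (-(2 * M * 4 ^ j))) := by
    intro j t ht
    have htT : t ∈ 𝒯 := hnet_sub (j + 1) ht
    have hdist := (hprj j t htT).2
    have hv : (0 : ℝ) < 4 * m * (16 ^ j : ℝ)⁻¹ := by positivity
    have := card_lt_abs_sum_swapSign_le (fun k => pairDiff t k - pairDiff (prj j t) k) hv
      ((sum_sq_pairDiff_sub_le t (prj j t)).trans (by linarith))
      (show 0 ≤ m * d * (2 ^ (j + 1) : ℝ)⁻¹ by positivity)
    refine this.trans (le_of_eq ?_)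
    congr 4
    have h16 : (16 : ℝ) ^ j = (2 ^ j) ^ 4 := by rw [← pow_mul, mul_comm, pow_mul]; norm_num
    have h4 : (4 : ℝ) ^ j = (2 ^ j) ^ 2 := by rw [← pow_mul, mul_comm, pow_mul]; norm_num
    rw [hM, h16, h4, pow_succ]
    field_simp
    ring
  -- Symmetric differences have integer size, so below radius `1` the nearest net point is the trace
  -- itself and the chain ends.
  obtain ⟨J, hJ⟩ : ∃ J : ℕ, (16 ^ (J + 1) : ℝ)⁻¹ * (2 * m) < 1 := by
    obtain ⟨J, hJ⟩ := pow_unbounded_of_one_lt (2 * m : ℝ) (show (1 : ℝ) < 16 by norm_num)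
    refine ⟨J, ?_⟩
    rw [inv_mul_lt_iff₀ (by positivity), mul_one, pow_succ]
    have : (0 : ℝ) < 16 ^ J := by positivity
    linarith
  have hsub : (univ.filter fun e : Fin m → Bool =>
      ∃ t ∈ 𝒯, m * d < |∑ k, swapSign (e k) * pairDiff t k|) ⊆
      (range (J + 1)).biUnion fun j => (T (j + 1)).biUnion (badLink j) := by
    intro e he
    by_contra hgood
    simp only [mem_biUnion, not_exists, not_and, badLink, mem_filter, mem_univ, true_and,
      not_lt, mem_range] at hgood
    have hind : ∀ j ≤ J + 1, ∀ t ∈ T j, |∑ k, swapSign (e k) * pairDiff t k| ≤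
        m * d * (1 - (2 ^ j : ℝ)⁻¹) := by
      intro j
      induction j with
      | zero =>
        intro _ t ht
        rw [hT0, mem_singleton] at ht
        simp [ht, pairDiff]
      | succ j ih =>
        intro hj t ht
        have htT : t ∈ 𝒯 := hnet_sub (j + 1) ht
        have h1 := ih (by omega) (prj j t) (hprj j t htT).1
        have h2 := hgood j (by omega) t ht
        simp_rw [mul_sub, sum_sub_distrib] at h2
        have h3 := abs_sub_abs_le_abs_sub (∑ k, swapSign (e k) * pairDiff t k)
          (∑ k, swapSign (e k) * pairDiff (prj j t) k)
        have h4 : (2 ^ j : ℝ)⁻¹ = 2 * (2 ^ (j + 1) : ℝ)⁻¹ := by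
          rw [pow_succ]; field_simp
        rw [h4] at h1
        nlinarith
    obtain ⟨t, ht, hlt⟩ := (mem_filter.1 he).2
    obtain ⟨u, hu, hdist⟩ := hTcover (J + 1) t ht
    have h0 : #(symmDiff t u) = 0 := by
      have : (#(symmDiff t u) : ℝ) < 1 := lt_of_le_of_lt hdist hJ
      have : #(symmDiff t u) < 1 := by exact_mod_cast this
      omega
    have htu : t = u := symmDiff_eq_bot.1 (card_eq_zero.1 h0)
    have h5 := hind (J + 1) le_rfl u hu
    rw [← htu] at h5
    have h6 : 0 ≤ m * d * (2 ^ (J + 1) : ℝ)⁻¹ := by positivity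
    nlinarith
  have hlevel : ∀ j : ℕ, (#((T (j + 1)).biUnion (badLink j)) : ℝ) ≤
      2 ^ m * (2 * Real.exp (-(M * (j + 1)))) := by
    intro j
    -- The union over a net spends half of the exponent `2 M 4 ^ j`, by `20 K ≤ M` and `j + 1 ≤ 4 ^
    -- j`.
    have hTcard : (#(T (j + 1)) : ℝ) ≤ Real.exp (M * 4 ^ j) := by
      refine (hpack (j + 1) (by omega) _ (hnet_sub _) (hnet_sep _)).trans ?_
      refine Real.exp_le_exp.2 ?_
      have hj4 : ((j + 1 : ℕ) : ℝ) ≤ 4 ^ j := by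
        have : j + 1 ≤ 4 ^ j := Nat.lt_pow_self (by norm_num)
        exact_mod_cast this
      have : (0 : ℝ) ≤ ((j + 1 : ℕ) : ℝ) := by positivity
      exact mul_le_mul hKd hj4 this (by linarith)
    have hj4 : ((j : ℝ) + 1) ≤ 4 ^ j := by
      have : j + 1 ≤ 4 ^ j := Nat.lt_pow_self (by norm_num)
      exact_mod_cast this
    calc (#((T (j + 1)).biUnion (badLink j)) : ℝ) ≤ ∑ t ∈ T (j + 1), (#(badLink j t) : ℝ) := by
          exact_mod_cast card_biUnion_le
      _ ≤ ∑ t ∈ T (j + 1), 2 ^ m * (2 * Real.exp (-(2 * M * 4 ^ j))) := sum_le_sum (hbadLink j)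
      _ = #(T (j + 1)) * (2 ^ m * (2 * Real.exp (-(2 * M * 4 ^ j)))) := by simp
      _ ≤ Real.exp (M * 4 ^ j) * (2 ^ m * (2 * Real.exp (-(2 * M * 4 ^ j)))) := by gcongr
      _ = 2 ^ m * (2 * Real.exp (-(M * 4 ^ j))) := by
          rw [show -(M * 4 ^ j) = M * 4 ^ j + -(2 * M * 4 ^ j) by ring, Real.exp_add]; ring
      _ ≤ _ := by
          have : 0 ≤ M := by linarith
          gcongr
  calc _ ≤ (#((range (J + 1)).biUnion fun j => (T (j + 1)).biUnion (badLink j)) : ℝ) := by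
        exact_mod_cast card_le_card hsub
    _ ≤ ∑ j ∈ range (J + 1), (#((T (j + 1)).biUnion (badLink j)) : ℝ) := by
        exact_mod_cast card_biUnion_le
    _ ≤ ∑ j ∈ range (J + 1), 2 ^ m * (2 * Real.exp (-(M * (j + 1)))) :=
        sum_le_sum fun j _ => hlevel j
    _ = 2 ^ m * ∑ j ∈ range (J + 1), 2 * Real.exp (-(M * (j + 1))) := by rw [mul_sum]
    _ ≤ _ := by
        gcongr
        exact sum_two_exp_le (by linarith) _

end Chaining

/-! ### Symmetrization and the uniform law of large numbers. -/

section UniformLaw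

open Finset

variable {Z I : Type*} {m : ℕ}

/-- The two halves of a sample of pairs, as one sample. -/
def unpair (W : Fin m → Z × Z) : Fin m ⊕ Fin m → Z :=
  Sum.elim (fun k => (W k).1) (fun k => (W k).2)

/-- Exchange the two components of the pairs selected by `e`. -/
def swapPairs (e : Fin m → Bool) (W : Fin m → Z × Z) : Fin m → Z × Z :=
  fun k => (bif e k then Prod.swap else id) (W k)

/-- The samples of pairs on which the two halves deviate by more than `d` for some set of the
family. -/
def deviationSet (D : I → Set Z) (m : ℕ) (d : ℝ) : Set (Fin m → Z × Z) :=
  {W | ∃ t ∈ traces D (unpair W), m * d < |∑ k, pairDiff t k|}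

/-- The proportion of the sample lying in the `i`-th set. -/
noncomputable def frequency (D : I → Set Z) (X : Fin m → Z) (i : I) : ℝ :=
  (1 / (m : ℝ)) * #(trace D X i)

lemma pairDiff_trace_swapPairs (D : I → Set Z) (e : Fin m → Bool) (W : Fin m → Z × Z) (i : I)
    (k : Fin m) : pairDiff (trace D (unpair (swapPairs e W)) i) k =
      swapSign (e k) * pairDiff (trace D (unpair W) i) k := by
  classical
  unfold pairDiff swapSign
  simp only [mem_trace, unpair, swapPairs, Sum.elim_inl, Sum.elim_inr]
  cases e k <;> simp

lemma sum_pairDiff_trace (D : I → Set Z) (X Y : Fin m → Z) (i : I) :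
    ∑ k, pairDiff (trace D (unpair fun k => (X k, Y k)) i) k =
      (#(trace D X i) : ℝ) - #(trace D Y i) := by
  classical
  simp only [pairDiff, sum_sub_distrib, sum_boole]
  congr 3 <;> ext k <;> simp [mem_trace, unpair]

variable [MeasurableSpace Z]

lemma measurable_unpair : Measurable (unpair : (Fin m → Z × Z) → Fin m ⊕ Fin m → Z) := by
  refine measurable_pi_lambda _ fun k => ?_
  rcases k with k | k
  · exact measurable_fst.comp (measurable_pi_apply k)
  · exact measurable_snd.comp (measurable_pi_apply k)

lemma measurableSet_deviationSet {D : I → Set Z}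
    (hmeas : ∀ t : Finset (Fin m ⊕ Fin m), MeasurableSet {z : Fin m ⊕ Fin m → Z | t ∈ traces D z})
    (d : ℝ) : MeasurableSet (deviationSet D m d) := by
  have : deviationSet D m d = ⋃ t ∈ {t : Finset (Fin m ⊕ Fin m) | m * d < |∑ k, pairDiff t k|},
      unpair ⁻¹' {z : Fin m ⊕ Fin m → Z | t ∈ traces D z} := by
    ext W
    simp only [deviationSet, Set.mem_ofPred_eq, Set.mem_iUnion, Set.mem_preimage, exists_prop]
    exact exists_congr fun t => and_comm
  rw [this]
  exact MeasurableSet.biUnion (Set.to_countable _) fun t _ => measurable_unpair (hmeas t)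

lemma measurePreserving_swapPairs (μ : Measure Z) [IsProbabilityMeasure μ] (e : Fin m → Bool) :
    MeasurePreserving (swapPairs e) (Measure.pi fun _ : Fin m => μ.prod μ)
      (Measure.pi fun _ : Fin m => μ.prod μ) := by
  refine measurePreserving_pi (fun _ : Fin m => μ.prod μ) (fun _ : Fin m => μ.prod μ)
    (f := fun k => bif e k then Prod.swap else id) fun k => ?_
  cases e k
  · exact MeasurePreserving.id _
  · exact Measure.measurePreserving_swap

/-- Swapping the members of pairs preserves the law, so the probability equals its average over all
`2 ^ m` swaps. For a fixed sample a swap only changes signs in the sum of differences, so the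
chaining bound applies pointwise. -/
lemma pi_prod_deviationSet_le (μ : Measure Z) [IsProbabilityMeasure μ] {D : I → Set Z}
    {K d : ℝ} {s : ℕ} (hm : 1 ≤ m) (hK : 1 ≤ K) (hsK : (s : ℝ) ≤ K) (hd : 0 < d)
    (hKd : 20 * K ≤ m * d ^ 2 / 64)
    (hD : ∀ (N : ℕ) (z : Fin N → Z) (b : ℝ), 1 ≤ b →
      (#(traces D z) : ℝ) ≤ (Real.exp K * (b ^ s * Real.exp (N / b))) ^ 2)
    (hmeas : ∀ t : Finset (Fin m ⊕ Fin m),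
      MeasurableSet {z : Fin m ⊕ Fin m → Z | t ∈ traces D z}) :
    (Measure.pi fun _ : Fin m => μ.prod μ) (deviationSet D m d) ≤
      ENNReal.ofReal (4 * Real.exp (-(m * d ^ 2 / 64))) := by
  classical
  set ν := Measure.pi fun _ : Fin m => μ.prod μ
  set S := deviationSet D m d with hS
  have hSm : MeasurableSet S := measurableSet_deviationSet hmeas d
  have : Nonempty (Fin m) := ⟨⟨0, by omega⟩⟩
  have hcount : ∀ W, (#(univ.filter fun e : Fin m → Bool => swapPairs e W ∈ S) : ℝ) ≤
      2 ^ m * (4 * Real.exp (-(m * d ^ 2 / 64))) := by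
    intro W
    refine le_trans (le_of_eq ?_) (card_exists_lt_abs_sum_le hm (traces D (unpair W)) hK hd hKd
      fun j hj P hP hsep => card_le_exp_of_separated hK hsK hD (unpair W) hj hP
        fun s hs t ht hst => ?_)
    · congr 2
      ext e
      simp only [hS, deviationSet, Set.mem_ofPred_eq, mem_filter, mem_univ, true_and, mem_traces,
        exists_exists_eq_and, pairDiff_trace_swapPairs]
    · have := hsep s hs t ht hst
      simpa [two_mul] using this
  have hpre : ∀ e : Fin m → Bool, ν S = ∫⁻ W, (swapPairs e ⁻¹' S).indicator 1 W ∂ν := by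
    intro e
    have hmp := measurePreserving_swapPairs μ e
    rw [lintegral_indicator_one (hmp.measurable hSm), hmp.measure_preimage hSm.nullMeasurableSet]
  have hsum : (2 : ENNReal) ^ m * ν S ≤
      2 ^ m * ENNReal.ofReal (4 * Real.exp (-(m * d ^ 2 / 64))) := by
    calc (2 : ENNReal) ^ m * ν S = ∑ _e : Fin m → Bool, ν S := by simp
      _ = ∑ e : Fin m → Bool, ∫⁻ W, (swapPairs e ⁻¹' S).indicator 1 W ∂ν :=
          sum_congr rfl fun e _ => hpre e
      _ = ∫⁻ W, ∑ e : Fin m → Bool, (swapPairs e ⁻¹' S).indicator 1 W ∂ν := by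
          rw [lintegral_finsetSum]
          intro e _
          exact measurable_one.indicator ((measurePreserving_swapPairs μ e).measurable hSm)
      _ ≤ ∫⁻ _W, 2 ^ m * ENNReal.ofReal (4 * Real.exp (-(m * d ^ 2 / 64))) ∂ν := by
          refine lintegral_mono fun W => ?_
          have h1 : ∑ e : Fin m → Bool, (swapPairs e ⁻¹' S).indicator (1 : (Fin m → Z × Z) → ENNReal) W =
              (#(univ.filter fun e : Fin m → Bool => swapPairs e W ∈ S) : ENNReal) := by
            rw [← sum_boole]
            refine sum_congr rfl fun e _ => ?_
            simp [Set.indicator_apply]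
          rw [h1]
          calc (#(univ.filter fun e : Fin m → Bool => swapPairs e W ∈ S) : ENNReal) =
                ENNReal.ofReal (#(univ.filter fun e : Fin m → Bool => swapPairs e W ∈ S) : ℝ) := by
                simp
            _ ≤ ENNReal.ofReal (2 ^ m * (4 * Real.exp (-(m * d ^ 2 / 64)))) :=
                ENNReal.ofReal_le_ofReal (hcount W)
            _ = _ := by
                rw [ENNReal.ofReal_mul (by positivity), ENNReal.ofReal_pow (by norm_num)]
                simp
      _ = _ := by simp
  exact (ENNReal.mul_le_mul_iff_right (by simp) (by simp)).1 hsum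

/-- Chebyshev's inequality, as an indicator has variance at most `1 / 4`. -/
lemma half_le_pi_abs_frequency_sub_le (μ : Measure Z) [IsProbabilityMeasure μ] {D : I → Set Z}
    {i : I} (hDi : MeasurableSet (D i)) {d : ℝ} (hd : 0 < d) (hmd : 1 ≤ m * d ^ 2) :
    1 / 2 ≤ (Measure.pi fun _ : Fin m => μ) {X | |frequency D X i - μ.real (D i)| ≤ d} := by
  classical
  have hm0 : (0 : ℝ) < m := by
    rcases Nat.eq_zero_or_pos m with rfl | h
    · norm_num at hmd
    · exact_mod_cast h
  set f : Z → ℝ := (D i).indicator 1 with hf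
  have hfm : Measurable f := measurable_one.indicator hDi
  have hfb : ∀ z, f z ∈ Set.Icc (0 : ℝ) 1 := fun z => by
    by_cases h : z ∈ D i <;> simp [hf, h]
  have hfL : MemLp f 2 μ := memLp_of_bounded (ae_of_all _ hfb) hfm.aestronglyMeasurable 2
  set F : (Fin m → Z) → ℝ := ∑ k, fun X => f (X k) with hF
  have hFeq : ∀ X, F X = #(trace D X i) := by
    intro X
    rw [hF, Finset.sum_apply, trace, ← sum_boole]
    refine sum_congr rfl fun k _ => ?_
    simp [hf, Set.indicator_apply]
  have hvar : Var[F; Measure.pi fun _ : Fin m => μ] ≤ m / 4 := by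
    rw [hF, variance_sum_pi (fun _ => hfL)]
    have hv : Var[f; μ] ≤ 1 / 4 :=
      (variance_le_sq_of_bounded (ae_of_all _ hfb) hfm.aemeasurable).trans (by norm_num)
    calc ∑ _k : Fin m, Var[f; μ] ≤ ∑ _k : Fin m, (1 / 4 : ℝ) := sum_le_sum fun _ _ => hv
      _ = m / 4 := by simp; ring
  have hFk : ∀ k : Fin m, MemLp (fun X : Fin m → Z => f (X k)) 2
      (Measure.pi fun _ : Fin m => μ) := fun k =>
    hfL.comp_measurePreserving (measurePreserving_eval (fun _ : Fin m => μ) k)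
  have hFL : MemLp F 2 (Measure.pi fun _ : Fin m => μ) := by
    rw [hF]
    exact memLp_finsetSum' _ fun k _ => hFk k
  have hmean : ∫ X, F X ∂(Measure.pi fun _ : Fin m => μ) = m * μ.real (D i) := by
    simp only [hF, Finset.sum_apply]
    rw [integral_finsetSum _ fun k _ => (hFk k).integrable (by norm_num)]
    have : ∀ k : Fin m, ∫ X, f (X k) ∂(Measure.pi fun _ : Fin m => μ) = μ.real (D i) := by
      intro k
      have hmp := measurePreserving_eval (fun _ : Fin m => μ) k
      have := integral_map (μ := Measure.pi fun _ : Fin m => μ) hmp.measurable.aemeasurable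
        (f := f) hfm.aestronglyMeasurable
      rw [hmp.map_eq] at this
      rw [show ∫ X, f (X k) ∂(Measure.pi fun _ : Fin m => μ) = ∫ y, f y ∂μ from this.symm, hf,
        integral_indicator_one hDi]
    simp [this]
  have hcheb := meas_ge_le_variance_div_sq hFL (show 0 < m * d by positivity)
  have hsmall : (Measure.pi fun _ : Fin m => μ)
      {X | |frequency D X i - μ.real (D i)| ≤ d}ᶜ ≤ 1 / 2 := by
    refine (measure_mono fun X hX => ?_).trans (hcheb.trans ?_)
    · simp only [Set.mem_compl_iff, Set.mem_ofPred_eq, not_le, frequency] at hX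
      simp only [Set.mem_ofPred_eq]
      rw [hmean, hFeq]
      have : (#(trace D X i) : ℝ) - m * μ.real (D i) =
          m * (1 / (m : ℝ) * #(trace D X i) - μ.real (D i)) := by field_simp
      rw [this, abs_mul, abs_of_pos hm0]
      gcongr
    · rw [show (1 / 2 : ENNReal) = ENNReal.ofReal (1 / 2) by
        rw [ENNReal.ofReal_div_of_pos (by norm_num)]; simp]
      refine ENNReal.ofReal_le_ofReal ?_
      rw [div_le_iff₀ (by positivity)]
      nlinarith
  have huniv := measure_univ_le_add_compl (μ := Measure.pi fun _ : Fin m => μ)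
    {X | |frequency D X i - μ.real (D i)| ≤ d}
  rw [measure_univ] at huniv
  have h1 : (1 : ENNReal) ≤ (Measure.pi fun _ : Fin m => μ)
      {X | |frequency D X i - μ.real (D i)| ≤ d} + 1 / 2 := huniv.trans (by gcongr)
  have h2 : (1 : ENNReal) - 1 / 2 = 1 / 2 := by
    rw [one_div]; exact ENNReal.one_sub_inv_two
  rw [← h2]
  exact tsub_le_iff_right.2 h1

/-- The uniform law of large numbers over a family of sets of polynomial growth, with the optimal
dependence of the sample size on the accuracy. -/
theorem pi_exists_lt_abs_frequency_sub_le (μ : Measure Z) [IsProbabilityMeasure μ] {D : I → Set Z}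
    {K δ : ℝ} {s : ℕ} (hm : 1 ≤ m) (hK : 1 ≤ K) (hsK : (s : ℝ) ≤ K) (hδ : 0 < δ)
    (hKδ : 20 * K ≤ m * δ ^ 2 / 256) (hDm : ∀ i, MeasurableSet (D i))
    (hD : ∀ (N : ℕ) (z : Fin N → Z) (b : ℝ), 1 ≤ b →
      (#(traces D z) : ℝ) ≤ (Real.exp K * (b ^ s * Real.exp (N / b))) ^ 2)
    (hmeas : ∀ t : Finset (Fin m ⊕ Fin m),
      MeasurableSet {z : Fin m ⊕ Fin m → Z | t ∈ traces D z}) :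
    (Measure.pi fun _ : Fin m => μ) {X | ∃ i, δ < |frequency D X i - μ.real (D i)|} ≤
      ENNReal.ofReal (8 * Real.exp (-(m * δ ^ 2 / 256))) := by
  classical
  have hm0 : (0 : ℝ) < m := by exact_mod_cast hm
  set d := δ / 2 with hd
  have hd0 : 0 < d := by positivity
  have hKd : 20 * K ≤ m * d ^ 2 / 64 := by rw [hd]; linarith
  set π := Measure.pi fun _ : Fin m => μ with hπ
  have hdev := pi_prod_deviationSet_le μ hm hK hsK hd0 hKd hD hmeas
  have hSm : MeasurableSet (deviationSet D m d) := measurableSet_deviationSet hmeas d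
  set zip : (Fin m → Z) × (Fin m → Z) → Fin m → Z × Z := fun q k => (q.1 k, q.2 k) with hzip
  have hmp : MeasurePreserving zip (π.prod π) (Measure.pi fun _ : Fin m => μ.prod μ) :=
    (measurePreserving_arrowProdEquivProdArrow Z Z (Fin m) (fun _ => μ) (fun _ => μ)).symm
  have hS' : MeasurableSet (zip ⁻¹' deviationSet D m d) := hmp.measurable hSm
  -- If `X` deviates by `δ` on the `i`-th set, a second sample is within `δ / 2` of the mean on that
  -- same set with probability at least `1 / 2`, so the two samples differ by more than `δ / 2`. The
  -- larger set is defined by a measurable section function, so Markov's inequality applies, at the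
  -- cost of a factor `2`.
  have hsec : {X | ∃ i, δ < |frequency D X i - μ.real (D i)|} ⊆
      {X | 1 / 2 ≤ π (Prod.mk X ⁻¹' (zip ⁻¹' deviationSet D m d))} := by
    rintro X ⟨i, hi⟩
    refine (half_le_pi_abs_frequency_sub_le (m := m) μ (hDm i) hd0 (by linarith)).trans
      (measure_mono fun Y hY => ?_)
    simp only [Set.mem_ofPred_eq] at hY
    refine ⟨_, mem_traces.2 ⟨i, rfl⟩, ?_⟩
    rw [hzip]
    simp only
    rw [sum_pairDiff_trace]
    have hlt : d < |frequency D X i - frequency D Y i| := by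
      have h1 := abs_sub_abs_le_abs_sub (frequency D X i - μ.real (D i))
        (frequency D Y i - μ.real (D i))
      rw [sub_sub_sub_cancel_right] at h1
      have : δ = d + d := by rw [hd]; ring
      linarith
    have heq : (#(trace D X i) : ℝ) - #(trace D Y i) =
        m * (frequency D X i - frequency D Y i) := by
      unfold frequency; field_simp
    rw [heq, abs_mul, abs_of_pos hm0]
    gcongr
  have hmarkov := mul_meas_ge_le_lintegral (μ := π)
    (measurable_measure_prodMk_left (ν := π) hS') (1 / 2)
  rw [← Measure.prod_apply hS', hmp.measure_preimage hSm.nullMeasurableSet] at hmarkov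
  calc π {X | ∃ i, δ < |frequency D X i - μ.real (D i)|}
      ≤ π {X | 1 / 2 ≤ π (Prod.mk X ⁻¹' (zip ⁻¹' deviationSet D m d))} := measure_mono hsec
    _ = 2 * (1 / 2 * π {X | 1 / 2 ≤ π (Prod.mk X ⁻¹' (zip ⁻¹' deviationSet D m d))}) := by
        rw [← mul_assoc, one_div, ENNReal.mul_inv_cancel (by simp) (by simp), one_mul]
    _ ≤ 2 * ENNReal.ofReal (4 * Real.exp (-(m * d ^ 2 / 64))) := by
        gcongr
        exact hmarkov.trans hdev
    _ = _ := by
        rw [show (2 : ENNReal) = ENNReal.ofReal 2 by simp, ← ENNReal.ofReal_mul (by norm_num)]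
        congr 1
        rw [hd, ← mul_assoc]
        ring_nf

end UniformLaw

/-! ### Planar Gaussian measure of sectors. -/

section PlanarGaussian

/-- The standard Gaussian measure on the plane. -/
noncomputable def planarGaussian : Measure (ℝ × ℝ) := (gaussianReal 0 1).prod (gaussianReal 0 1)

instance : IsProbabilityMeasure planarGaussian := by unfold planarGaussian; infer_instance

lemma gaussianPDF_mul_gaussianPDF_polar (r φ : ℝ) :
    gaussianPDF 0 1 (r * Real.cos φ) * gaussianPDF 0 1 (r * Real.sin φ) =
      gaussianPDF 0 1 r * gaussianPDF 0 1 0 := by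
  simp only [gaussianPDF]
  rw [← ENNReal.ofReal_mul (gaussianPDFReal_nonneg _ _ _),
    ← ENNReal.ofReal_mul (gaussianPDFReal_nonneg _ _ _)]
  congr 1
  simp only [gaussianPDFReal]
  have h : ∀ c a b : ℝ, c * Real.exp a * (c * Real.exp b) = c * c * Real.exp (a + b) :=
    fun c a b => by rw [Real.exp_add]; ring
  rw [h, h]
  congr 2
  simp only [sub_zero, mul_pow]
  have := Real.sin_sq_add_cos_sq φ
  push_cast
  linear_combination (-(r ^ 2) / 2) * this

/-- The radial factor of the planar Gaussian measure in polar coordinates. -/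
noncomputable def radialMass : ENNReal :=
  ∫⁻ r in Set.Ioi (0 : ℝ), ENNReal.ofReal r * (gaussianPDF 0 1 r * gaussianPDF 0 1 0)

/-- The planar Gaussian measure of a sector is proportional to its angle. -/
lemma planarGaussian_sector_eq_mul {S : Set (ℝ × ℝ)} (hS : MeasurableSet S) {Φ : Set ℝ}
    (hΦ : MeasurableSet Φ)
    (hSΦ : ∀ r φ : ℝ, 0 < r → φ ∈ Set.Ioo (-Real.pi) Real.pi →
      ((r * Real.cos φ, r * Real.sin φ) ∈ S ↔ φ ∈ Φ)) :
    planarGaussian S = radialMass * volume (Φ ∩ Set.Ioo (-Real.pi) Real.pi) := by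
  have hg : Measurable (gaussianPDF 0 1) := measurable_gaussianPDF 0 1
  have hdens : planarGaussian = (volume : Measure (ℝ × ℝ)).withDensity
      fun p => gaussianPDF 0 1 p.1 * gaussianPDF 0 1 p.2 := by
    rw [planarGaussian, gaussianReal_of_var_ne_zero _ one_ne_zero, prod_withDensity hg hg]
    rfl
  rw [hdens, withDensity_apply _ hS, ← lintegral_indicator hS, ← lintegral_comp_polarCoord_symm]
  have htarget : polarCoord.target = Set.Ioi (0 : ℝ) ×ˢ Set.Ioo (-Real.pi) Real.pi := rfl
  have hcongr : ∫⁻ p in polarCoord.target, ENNReal.ofReal p.1 •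
      S.indicator (fun p : ℝ × ℝ => gaussianPDF 0 1 p.1 * gaussianPDF 0 1 p.2)
        (polarCoord.symm p) =
      ∫⁻ p in polarCoord.target, (ENNReal.ofReal p.1 * (gaussianPDF 0 1 p.1 * gaussianPDF 0 1 0)) *
        Φ.indicator 1 p.2 := by
    refine setLIntegral_congr_fun polarCoord.open_target.measurableSet fun p hp => ?_
    have hpp := hSΦ p.1 p.2 hp.1 hp.2
    simp only [polarCoord_symm_apply, smul_eq_mul]
    by_cases h : p.2 ∈ Φ
    · rw [Set.indicator_of_mem (hpp.2 h), Set.indicator_of_mem h,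
        gaussianPDF_mul_gaussianPDF_polar]
      simp
    · rw [Set.indicator_of_notMem (mt hpp.1 h), Set.indicator_of_notMem h]
      simp
  rw [hcongr, htarget, Measure.volume_eq_prod, ← Measure.prod_restrict,
    lintegral_prod_mul (f := fun r => ENNReal.ofReal r * (gaussianPDF 0 1 r * gaussianPDF 0 1 0))
      (by fun_prop) (by exact (measurable_one.indicator hΦ).aemeasurable),
    lintegral_indicator_one hΦ, Measure.restrict_apply hΦ, radialMass]

/-- The radial integral need not be computed: the whole plane has mass `1` and angle `2π`. -/
lemma planarGaussian_sector {S : Set (ℝ × ℝ)} (hS : MeasurableSet S) {Φ : Set ℝ}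
    (hΦ : MeasurableSet Φ)
    (hSΦ : ∀ r φ : ℝ, 0 < r → φ ∈ Set.Ioo (-Real.pi) Real.pi →
      ((r * Real.cos φ, r * Real.sin φ) ∈ S ↔ φ ∈ Φ)) :
    planarGaussian.real S = volume.real (Φ ∩ Set.Ioo (-Real.pi) Real.pi) / (2 * Real.pi) := by
  have huniv := planarGaussian_sector_eq_mul MeasurableSet.univ MeasurableSet.univ
    (fun r φ _ _ => by simp)
  rw [measure_univ, Set.univ_inter, Real.volume_Ioo] at huniv
  have h1 := congrArg ENNReal.toReal huniv
  have hpi := Real.pi_pos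
  rw [ENNReal.toReal_mul, ENNReal.toReal_ofReal (by linarith), ENNReal.toReal_one] at h1
  rw [measureReal_def, planarGaussian_sector_eq_mul hS hΦ hSΦ, ENNReal.toReal_mul, measureReal_def,
    eq_div_iff (by positivity)]
  linear_combination (-(volume (Φ ∩ Set.Ioo (-Real.pi) Real.pi)).toReal) * h1

lemma planarGaussian_pos_nonpos {ρ : ℝ} (h1 : -1 ≤ ρ) (h2 : ρ ≤ 1) :
    planarGaussian.real {g | 0 < g.1 ∧ ρ * g.1 + √(1 - ρ ^ 2) * g.2 ≤ 0} =
      Real.arccos ρ / (2 * Real.pi) := by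
  set θ := Real.arccos ρ with hθ
  have hpi := Real.pi_pos
  have hθ0 : 0 ≤ θ := Real.arccos_nonneg ρ
  have hθπ : θ ≤ Real.pi := Real.arccos_le_pi ρ
  have hcos : Real.cos θ = ρ := Real.cos_arccos h1 h2
  have hsin : Real.sin θ = √(1 - ρ ^ 2) := Real.sin_arccos ρ
  have hS : MeasurableSet {g : ℝ × ℝ | 0 < g.1 ∧ ρ * g.1 + √(1 - ρ ^ 2) * g.2 ≤ 0} :=
    (measurableSet_lt measurable_const measurable_fst).inter
      (measurableSet_le
        (by fun_prop : Measurable fun g : ℝ × ℝ => ρ * g.1 + √(1 - ρ ^ 2) * g.2) measurable_const)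
  -- With `ρ = cos θ` the second form is `r cos (θ - φ)`, so the sector has angle `θ`. Removing `π /
  -- 2` matters only for `θ = π`, where the endpoint violates `0 < cos φ`.
  have hΦ : MeasurableSet (Set.Ioc (-(Real.pi / 2)) (θ - Real.pi / 2) \ {Real.pi / 2}) :=
    measurableSet_Ioc.diff (measurableSet_singleton _)
  rw [planarGaussian_sector hS hΦ]
  · congr 1
    have hinter : (Set.Ioc (-(Real.pi / 2)) (θ - Real.pi / 2) \ {Real.pi / 2}) ∩
        Set.Ioo (-Real.pi) Real.pi =
        Set.Ioc (-(Real.pi / 2)) (θ - Real.pi / 2) \ {Real.pi / 2} := by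
      refine Set.inter_eq_left.2 fun φ hφ => ?_
      simp only [Set.mem_sdiff, Set.mem_Ioc] at hφ
      constructor <;> linarith [hφ.1.1, hφ.1.2]
    rw [hinter, measureReal_def, measure_sdiff_null (Real.volume_singleton), Real.volume_Ioc,
      ENNReal.toReal_ofReal (by linarith)]
    ring
  · intro r φ hr hφ
    have hlin : ρ * (r * Real.cos φ) + √(1 - ρ ^ 2) * (r * Real.sin φ) =
        r * Real.cos (θ - φ) := by
      rw [Real.cos_sub, hcos, hsin]; ring
    simp only [Set.mem_ofPred_eq, hlin, Set.mem_sdiff, Set.mem_Ioc, Set.mem_singleton_iff,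
      mul_pos_iff_of_pos_left hr, mul_nonpos_iff_pos_imp_nonpos]
    constructor
    · rintro ⟨hpos, hneg⟩
      have hneg' : Real.cos (θ - φ) ≤ 0 := hneg.1 hr
      have hφ1 : -(Real.pi / 2) < φ := by
        by_contra! h
        have := Real.cos_nonpos_of_pi_div_two_le_of_le (x := -φ) (by linarith)
          (by linarith [hφ.1])
        rw [Real.cos_neg] at this
        linarith
      have hφ2 : φ < Real.pi / 2 := by
        by_contra! h
        have := Real.cos_nonpos_of_pi_div_two_le_of_le (x := φ) h (by linarith [hφ.2])
        linarith
      refine ⟨⟨hφ1, ?_⟩, hφ2.ne⟩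
      by_contra! h
      have := Real.cos_pos_of_mem_Ioo (x := θ - φ) ⟨by linarith, by linarith⟩
      linarith
    · rintro ⟨⟨hφ1, hφ2⟩, hne⟩
      have hφ3 : φ < Real.pi / 2 := lt_of_le_of_ne (by linarith) hne
      refine ⟨Real.cos_pos_of_mem_Ioo ⟨hφ1, hφ3⟩, ?_⟩
      have := Real.cos_nonpos_of_pi_div_two_le_of_le (x := θ - φ) (by linarith) (by linarith)
      exact ⟨fun _ => this, fun _ => hr.le⟩

end PlanarGaussian

/-! ### Probability that a random row separates two points. -/

section RowLaw

/-- The joint law of a row of the matrix and the corresponding noise value. -/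
noncomputable def rowLaw (n : ℕ) (σ : ℝ) : Measure ((Fin n → ℝ) × ℝ) :=
  (Measure.pi fun _ : Fin n => gaussianReal 0 1).prod (gaussianReal 0 (σ ^ 2).toNNReal)

instance (n : ℕ) (σ : ℝ) : IsProbabilityMeasure (rowLaw n σ) := by unfold rowLaw; infer_instance

lemma charFunDual_gaussianReal_zero (v : NNReal) (L : StrongDual ℝ ℝ) :
    charFunDual (gaussianReal 0 v) L = Complex.exp (-(v * L 1 ^ 2 / 2 : ℝ)) := by
  have h := charFun_gaussianReal (μ := 0) (v := v) (L 1)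
  rw [charFun_apply_real] at h
  rw [charFunDual_apply]
  have hL : ∀ x : ℝ, L x = L 1 * x := fun x => by
    conv_lhs => rw [← mul_one x, ← smul_eq_mul, map_smul, smul_eq_mul, mul_comm]
  calc ∫ x, Complex.exp (L x * Complex.I) ∂(gaussianReal 0 v) =
      ∫ x, Complex.exp (L 1 * x * Complex.I) ∂(gaussianReal 0 v) := by
        congr 1; ext x; rw [hL x]; push_cast; rfl
    _ = _ := by rw [h]; congr 1; push_cast; ring

/-- The two real numbers whose signs are the bits of `x` and `y`. -/
noncomputable def measurementPair {n : ℕ} (x y : EuclideanSpace ℝ (Fin n)) :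
    ((Fin n → ℝ) × ℝ) →L[ℝ] ℝ × ℝ :=
  LinearMap.toContinuousLinearMap
    { toFun := fun z => (z.1 ⬝ᵥ x.ofLp + z.2, z.1 ⬝ᵥ y.ofLp + z.2)
      map_add' := fun z w => by
        ext <;> simp only [Prod.fst_add, Prod.snd_add, add_dotProduct] <;> ring
      map_smul' := fun c z => by
        ext <;> simp [smul_dotProduct] <;> ring }

lemma measurementPair_apply {n : ℕ} (x y : EuclideanSpace ℝ (Fin n)) (z : (Fin n → ℝ) × ℝ) :
    measurementPair x y z = (z.1 ⬝ᵥ x.ofLp + z.2, z.1 ⬝ᵥ y.ofLp + z.2) := rfl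

/-- A pair of correlated centred Gaussian variables of variance `c ^ 2` and correlation `ρ`, as a
function of a standard Gaussian pair. -/
noncomputable def correlatedPair (c ρ : ℝ) : (ℝ × ℝ) →L[ℝ] ℝ × ℝ :=
  LinearMap.toContinuousLinearMap
    { toFun := fun g => (c * g.1, c * (ρ * g.1 + √(1 - ρ ^ 2) * g.2))
      map_add' := fun z w => by
        ext <;> simp only [Prod.fst_add, Prod.snd_add] <;> ring
      map_smul' := fun c z => by
        ext <;> simp <;> ring }

lemma correlatedPair_apply (c ρ : ℝ) (g : ℝ × ℝ) :
    correlatedPair c ρ g = (c * g.1, c * (ρ * g.1 + √(1 - ρ ^ 2) * g.2)) := rfl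

lemma dual_prod_apply (L : StrongDual ℝ (ℝ × ℝ)) (p q : ℝ) :
    L (p, q) = L (1, 0) * p + L (0, 1) * q := by
  have : ((p, q) : ℝ × ℝ) = p • (1, 0) + q • (0, 1) := by ext <;> simp
  rw [this, map_add, map_smul, map_smul]
  simp [mul_comm]

/-- Both sides are centred Gaussian with the same covariance, since the shared noise adds `σ²` to
the variances and to the covariance. Comparing characteristic functions also covers degenerate cases
such as `σ = 0` or `ρ = ±1`. -/
lemma map_measurementPair_rowLaw {n : ℕ} {σ : ℝ} {x y : EuclideanSpace ℝ (Fin n)}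
    (hx : ‖x‖ = 1) (hy : ‖y‖ = 1) {c ρ : ℝ} (hc : c ^ 2 = 1 + σ ^ 2)
    (hρ : c ^ 2 * ρ = inner ℝ x y + σ ^ 2) (hρ1 : ρ ^ 2 ≤ 1) :
    (rowLaw n σ).map (measurementPair x y) = planarGaussian.map (correlatedPair c ρ) := by
  have hp1 : IsProbabilityMeasure ((rowLaw n σ).map (measurementPair x y)) :=
    Measure.isProbabilityMeasure_map (by fun_prop)
  have hp2 : IsProbabilityMeasure (planarGaussian.map (correlatedPair c ρ)) :=
    Measure.isProbabilityMeasure_map (by fun_prop)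
  apply Measure.ext_of_charFunDual
  ext L
  rw [charFunDual_map, charFunDual_map, rowLaw, planarGaussian, charFunDual_prod,
    charFunDual_prod, charFunDual_pi]
  simp_rw [charFunDual_gaussianReal_zero]
  rw [← Complex.exp_sum, ← Complex.exp_add, ← Complex.exp_add]
  congr 1
  simp only [ContinuousLinearMap.comp_apply, ContinuousLinearMap.inl_apply,
    ContinuousLinearMap.inr_apply, ContinuousLinearMap.single_apply, measurementPair_apply,
    correlatedPair_apply]
  have hxx : ∑ i, x i ^ 2 = 1 := by rw [← EuclideanSpace.real_norm_sq_eq, hx]; norm_num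
  have hyy : ∑ i, y i ^ 2 = 1 := by rw [← EuclideanSpace.real_norm_sq_eq, hy]; norm_num
  have hxy : ∑ i, x i * y i = inner ℝ x y := by
    simp [PiLp.inner_apply, mul_comm]
  have hsq : √(1 - ρ ^ 2) ^ 2 = 1 - ρ ^ 2 := Real.sq_sqrt (by linarith)
  have hσ : ((σ ^ 2).toNNReal : ℝ) = σ ^ 2 := Real.coe_toNNReal _ (sq_nonneg σ)
  set α := L (1, 0) with hα
  set β := L (0, 1) with hβ
  have hL : ∀ p q : ℝ, L (p, q) = α * p + β * q := dual_prod_apply L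
  have hsum : ∑ i, (α * x i + β * y i) ^ 2 = α ^ 2 + 2 * α * β * inner ℝ x y + β ^ 2 := by
    calc ∑ i, (α * x i + β * y i) ^ 2 =
        ∑ i, (α ^ 2 * x i ^ 2 + 2 * α * β * (x i * y i) + β ^ 2 * y i ^ 2) :=
          Finset.sum_congr rfl fun i _ => by ring
      _ = _ := by
          rw [Finset.sum_add_distrib, Finset.sum_add_distrib, ← Finset.mul_sum, ← Finset.mul_sum,
            ← Finset.mul_sum, hxx, hyy, hxy]
          ring
  simp only [hL, single_one_dotProduct, zero_dotProduct, zero_add, add_zero, mul_zero, mul_one,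
    NNReal.coe_one, one_mul, hσ]
  norm_cast
  rw [Finset.sum_neg_distrib, ← Finset.sum_div, hsum]
  linear_combination (α * β) * hρ + ((α ^ 2 + β ^ 2) / 2) * hc
    + (c ^ 2 * β ^ 2 / 2) * hsq

lemma measurableSet_positiveSet {n : ℕ} (x : EuclideanSpace ℝ (Fin n)) :
    MeasurableSet (positiveSet x) := by
  refine measurableSet_lt measurable_const (Continuous.measurable ?_)
  exact (continuous_fst.dotProduct continuous_const).add continuous_snd

/-- Signs ignore the positive factor `c = √(1 + σ²)`, so only the sector of the normalized pair
remains. -/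
lemma rowLaw_positiveSet_diff {n : ℕ} (σ : ℝ) {x y : EuclideanSpace ℝ (Fin n)}
    (hx : ‖x‖ = 1) (hy : ‖y‖ = 1) :
    (rowLaw n σ).real (positiveSet x \ positiveSet y) = distortedDist σ x y / 2 := by
  have hσ : 0 < 1 + σ ^ 2 := by positivity
  set c := √(1 + σ ^ 2) with hc
  have hc0 : 0 < c := Real.sqrt_pos.2 hσ
  have hc2 : c ^ 2 = 1 + σ ^ 2 := Real.sq_sqrt hσ.le
  set ρ := (inner ℝ x y + σ ^ 2) / (1 + σ ^ 2) with hρ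
  have hρ' : c ^ 2 * ρ = inner ℝ x y + σ ^ 2 := by rw [hc2, hρ]; field_simp
  have hin : |inner ℝ x y| ≤ 1 := by
    have := abs_real_inner_le_norm x y
    rwa [hx, hy, one_mul] at this
  have hin' := abs_le.1 hin
  have h1 : -1 ≤ ρ := by rw [hρ, le_div_iff₀ hσ]; nlinarith
  have h2 : ρ ≤ 1 := by rw [hρ, div_le_iff₀ hσ]; linarith
  have hmap := map_measurementPair_rowLaw (σ := σ) hx hy hc2 hρ' (by nlinarith)
  have hQ : MeasurableSet {q : ℝ × ℝ | 0 < q.1 ∧ q.2 ≤ 0} :=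
    (measurableSet_lt measurable_const measurable_fst).inter
      (measurableSet_le measurable_snd measurable_const)
  have e1 : positiveSet x \ positiveSet y =
      measurementPair x y ⁻¹' {q : ℝ × ℝ | 0 < q.1 ∧ q.2 ≤ 0} := by
    ext z
    simp [positiveSet, measurementPair_apply]
  have e2 : correlatedPair c ρ ⁻¹' {q : ℝ × ℝ | 0 < q.1 ∧ q.2 ≤ 0} =
      {g | 0 < g.1 ∧ ρ * g.1 + √(1 - ρ ^ 2) * g.2 ≤ 0} := by
    ext g
    simp only [Set.mem_preimage, correlatedPair_apply, Set.mem_ofPred_eq,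
      mul_pos_iff_of_pos_left hc0]
    refine and_congr_right fun _ => ⟨fun h => ?_, fun h => ?_⟩
    · by_contra! h'
      exact absurd (mul_pos hc0 h') (not_lt.2 h)
    · exact mul_nonpos_of_nonneg_of_nonpos hc0.le h
  rw [e1, ← map_measureReal_apply (by fun_prop) hQ, hmap, map_measureReal_apply (by fun_prop) hQ,
    e2, planarGaussian_pos_nonpos h1 h2, distortedDist, ← hρ]
  field_simp

lemma rowLaw_separatingSet {n : ℕ} (σ : ℝ) {x y : EuclideanSpace ℝ (Fin n)}
    (hx : ‖x‖ = 1) (hy : ‖y‖ = 1) :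
    (rowLaw n σ).real (separatingSet x y) = distortedDist σ x y := by
  have hsymm : distortedDist σ y x = distortedDist σ x y := by
    unfold distortedDist; rw [real_inner_comm]
  rw [separatingSet, Set.symmDiff_def, measureReal_union
    (Set.disjoint_left.2 fun z h1 h2 => h1.2 h2.1)
    ((measurableSet_positiveSet y).diff (measurableSet_positiveSet x)),
    rowLaw_positiveSet_diff σ hx hy, rowLaw_positiveSet_diff σ hy hx, hsymm]
  ring

lemma measurableSet_separatingSet {n : ℕ} (x y : EuclideanSpace ℝ (Fin n)) :
    MeasurableSet (separatingSet x y) :=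
  (measurableSet_positiveSet x).symmDiff (measurableSet_positiveSet y)

end RowLaw

/-! ### The sample of rows and noise values is i.i.d. -/

section Model

lemma map_toLp_pi_gaussianReal (m : ℕ) (σ : ℝ) :
    (Measure.pi fun _ : Fin m => gaussianReal 0 (σ ^ 2).toNNReal).map (WithLp.toLp 2) =
      multivariateGaussian 0 (σ ^ 2 • (1 : Matrix (Fin m) (Fin m) ℝ)) := by
  have hp : IsProbabilityMeasure ((Measure.pi fun _ : Fin m =>
      gaussianReal 0 (σ ^ 2).toNNReal).map (WithLp.toLp 2)) :=
    Measure.isProbabilityMeasure_map (by fun_prop)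
  apply Measure.ext_of_charFun (E := EuclideanSpace ℝ (Fin m))
  ext t
  have hpos : (σ ^ 2 • (1 : Matrix (Fin m) (Fin m) ℝ)).PosSemidef :=
    Matrix.PosSemidef.one.smul (sq_nonneg σ)
  rw [charFun_multivariateGaussian hpos, charFun_pi]
  simp_rw [charFun_gaussianReal]
  rw [← Complex.exp_sum]
  congr 1
  have hσ : ((σ ^ 2).toNNReal : ℝ) = σ ^ 2 := Real.coe_toNNReal _ (sq_nonneg σ)
  simp [hσ, Matrix.smul_mulVec, dotProduct, Finset.sum_div]
  refine Finset.sum_congr rfl fun i _ => ?_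
  ring

/-- Independence of the rows, of the noise coordinates, and of the matrix from the noise makes the
joint law a product, which is then regrouped index by index. -/
lemma IsGaussianModel.hasLaw {m n : ℕ} {Ω : Type u} [MeasurableSpace Ω] {P : Measure Ω}
    [IsProbabilityMeasure P] {σ : ℝ} {A : Ω → Matrix (Fin m) (Fin n) ℝ}
    {η : Ω → EuclideanSpace ℝ (Fin m)} (h : IsGaussianModel P σ A η) :
    HasLaw (fun ω k => (A ω k, η ω k)) (Measure.pi fun _ : Fin m => rowLaw n σ) P := by
  have hmp1 : MeasurePreserving (WithLp.ofLp : EuclideanSpace ℝ (Fin n) → Fin n → ℝ)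
      (stdGaussian (EuclideanSpace ℝ (Fin n))) (Measure.pi fun _ => gaussianReal 0 1) := by
    refine ⟨by fun_prop, ?_⟩
    rw [← map_pi_eq_stdGaussian, Measure.map_map (by fun_prop) (by fun_prop)]
    exact Measure.map_id
  have hmp2 : MeasurePreserving (WithLp.ofLp : EuclideanSpace ℝ (Fin m) → Fin m → ℝ)
      (multivariateGaussian 0 (σ ^ 2 • (1 : Matrix (Fin m) (Fin m) ℝ)))
      (Measure.pi fun _ => gaussianReal 0 (σ ^ 2).toNNReal) := by
    refine ⟨by fun_prop, ?_⟩
    rw [← map_toLp_pi_gaussianReal, Measure.map_map (by fun_prop) (by fun_prop)]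
    exact Measure.map_id
  have hrow : ∀ k : Fin m, HasLaw (fun ω => (A ω k : Fin n → ℝ))
      (Measure.pi fun _ => gaussianReal 0 1) P := fun k => hmp1.hasLaw.comp (h.row_law k)
  have hA := h.row_indep.hasLaw_pi hrow
  have hη : HasLaw (fun ω => (η ω).ofLp) (Measure.pi fun _ => gaussianReal 0 (σ ^ 2).toNNReal) P :=
    hmp2.hasLaw.comp h.noise_law
  have hind : IndepFun (fun ω (k : Fin m) => (A ω k : Fin n → ℝ)) (fun ω => (η ω).ofLp) P :=
    h.indep.comp (ψ := WithLp.ofLp) measurable_id (by fun_prop)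
  have hjoint := hind.hasLaw_prod hA hη
  have hzip := (measurePreserving_arrowProdEquivProdArrow (Fin n → ℝ) ℝ (Fin m)
    (fun _ => Measure.pi fun _ : Fin n => gaussianReal 0 1)
    (fun _ => gaussianReal 0 (σ ^ 2).toNNReal)).symm
  exact hzip.hasLaw.comp hjoint

end Model

/-! ### Measurability of the trace events. -/

section Measurability

lemma isCompact_sparseSphere (n s : ℕ) : IsCompact (sparseSphere n s) := by
  classical
  have h : sparseSphere n s = Metric.sphere (0 : EuclideanSpace ℝ (Fin n)) 1 ∩
      ⋃ T ∈ {T : Finset (Fin n) | T.card ≤ s}, {x | ∀ j ∉ T, x j = 0} := by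
    ext x
    simp only [sparseSphere, Set.mem_ofPred_eq, Set.mem_inter_iff, mem_sphere_iff_norm, sub_zero,
      Set.mem_iUnion, exists_prop]
    refine and_congr_right fun _ => ⟨fun hx => ?_, ?_⟩
    · refine ⟨Finset.univ.filter fun j => x j ≠ 0, ?_, fun j hj => by simpa using hj⟩
      rw [Set.ncard_eq_toFinset_card'] at hx
      simpa using hx
    · rintro ⟨T, hT, hx⟩
      refine le_trans ?_ hT
      rw [← Set.ncard_coe_finset]
      refine Set.ncard_le_ncard (fun j hj => ?_) (Set.toFinite _)
      by_contra h
      exact hj (hx j h)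
  rw [h]
  refine (isCompact_sphere _ _).inter_right ?_
  refine Set.Finite.isClosed_biUnion (Set.toFinite _) fun T _ => ?_
  simp only [Set.ofPred_forall]
  refine isClosed_iInter fun j => isClosed_iInter fun _ => ?_
  exact isClosed_eq (by fun_prop) continuous_const

/-- The uncountable union over `x` is a projection along a compact space, which preserves closed
sets. The strict inequalities are written as countably many closed conditions; one bound `1 / (r +
1)` serves all of the finitely many indices. -/
lemma measurableSet_mem_traces_positiveSet {n s : ℕ} {ι : Type*} [Fintype ι] (t : Finset ι) :
    MeasurableSet {z : ι → (Fin n → ℝ) × ℝ |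
      t ∈ traces (fun x : sparseSphere n s => positiveSet x.1) z} := by
  have hcompact : CompactSpace (sparseSphere n s) :=
    isCompact_iff_compactSpace.1 (isCompact_sparseSphere n s)
  let val : ι → (ι → (Fin n → ℝ) × ℝ) × sparseSphere n s → ℝ :=
    fun k q => (q.1 k).1 ⬝ᵥ q.2.1.ofLp + (q.1 k).2
  have hval : ∀ k, Continuous (val k) := fun k => by
    refine Continuous.add (Continuous.dotProduct (by fun_prop) ?_) (by fun_prop)
    exact (PiLp.continuous_ofLp 2 _).comp (continuous_subtype_val.comp continuous_snd)
  have hset : {z : ι → (Fin n → ℝ) × ℝ |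
      t ∈ traces (fun x : sparseSphere n s => positiveSet x.1) z} =
      ⋃ r : ℕ, Prod.fst '' {q : (ι → (Fin n → ℝ) × ℝ) × sparseSphere n s |
        (∀ k ∈ t, 1 / ((r : ℝ) + 1) ≤ val k q) ∧ ∀ k ∉ t, val k q ≤ 0} := by
    ext z
    simp only [Set.mem_ofPred_eq, mem_traces, Set.mem_iUnion, Set.mem_image, Prod.exists,
      exists_and_right, exists_eq_right]
    have hmem : ∀ x : sparseSphere n s, trace (fun x : sparseSphere n s => positiveSet x.1) z x = t ↔
        ∀ k, 0 < val k (z, x) ↔ k ∈ t := by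
      intro x
      rw [Finset.ext_iff]
      simp only [mem_trace]
      rfl
    simp_rw [hmem]
    constructor
    · rintro ⟨x, hx⟩
      obtain ⟨c, hc0, hc⟩ : ∃ c : ℝ, 0 < c ∧ ∀ k ∈ t, c ≤ val k (z, x) := by
        rcases t.eq_empty_or_nonempty with rfl | hne
        · exact ⟨1, one_pos, by simp⟩
        · obtain ⟨k, hk, hmin⟩ := t.exists_min_image (fun k => val k (z, x)) hne
          exact ⟨val k (z, x), (hx k).2 hk, hmin⟩
      obtain ⟨r, hr⟩ := exists_nat_one_div_lt hc0
      exact ⟨r, x, fun k hk => hr.le.trans (hc k hk), fun k hk => not_lt.1 (mt (hx k).1 hk)⟩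
    · rintro ⟨r, x, h1, h2⟩
      refine ⟨x, fun k => ⟨fun hk => ?_, fun hk => ?_⟩⟩
      · by_contra h
        exact absurd hk (not_lt.2 (h2 k h))
      · exact lt_of_lt_of_le (by positivity) (h1 k hk)
  rw [hset]
  refine MeasurableSet.iUnion fun r => IsClosed.measurableSet ?_
  refine isClosedMap_fst_of_compactSpace _ ?_
  simp only [Set.ofPred_and, Set.ofPred_forall]
  refine IsClosed.inter (isClosed_iInter fun k => isClosed_iInter fun _ => ?_)
    (isClosed_iInter fun k => isClosed_iInter fun _ => ?_)
  · exact isClosed_le continuous_const (hval k)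
  · exact isClosed_le (hval k) continuous_const

lemma measurableSet_mem_traces_separatingSet {n s : ℕ} {ι : Type*} [Fintype ι] (t : Finset ι) :
    MeasurableSet {z : ι → (Fin n → ℝ) × ℝ |
      t ∈ traces (fun p : sparseSphere n s × sparseSphere n s =>
        separatingSet p.1.1 p.2.1) z} := by
  classical
  have htrace : ∀ (z : ι → (Fin n → ℝ) × ℝ) (x y : sparseSphere n s),
      trace (fun p : sparseSphere n s × sparseSphere n s => separatingSet p.1.1 p.2.1) z (x, y) =
        symmDiff (trace (fun x : sparseSphere n s => positiveSet x.1) z x)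
          (trace (fun x : sparseSphere n s => positiveSet x.1) z y) := by
    intro z x y
    ext k
    simp [Finset.mem_symmDiff, mem_trace, separatingSet, Set.mem_symmDiff]
  have hset : {z : ι → (Fin n → ℝ) × ℝ |
      t ∈ traces (fun p : sparseSphere n s × sparseSphere n s => separatingSet p.1.1 p.2.1) z} =
      ⋃ q ∈ {q : Finset ι × Finset ι | symmDiff q.1 q.2 = t},
        {z : ι → (Fin n → ℝ) × ℝ |
          q.1 ∈ traces (fun x : sparseSphere n s => positiveSet x.1) z} ∩
        {z : ι → (Fin n → ℝ) × ℝ |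
          q.2 ∈ traces (fun x : sparseSphere n s => positiveSet x.1) z} := by
    ext z
    simp only [Set.mem_ofPred_eq, Set.mem_iUnion, Set.mem_inter_iff, exists_prop, mem_traces,
      Prod.exists, htrace]
    constructor
    · rintro ⟨x, y, h⟩
      exact ⟨_, _, h, ⟨x, rfl⟩, ⟨y, rfl⟩⟩
    · rintro ⟨_, _, h, ⟨x, rfl⟩, ⟨y, rfl⟩⟩
      exact ⟨x, y, h⟩
  rw [hset]
  exact MeasurableSet.biUnion (Set.to_countable _) fun q _ =>
    (measurableSet_mem_traces_positiveSet q.1).inter (measurableSet_mem_traces_positiveSet q.2)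

end Measurability

/-! ### The RIP from the uniform law. -/

section Main

lemma hammingMetric_noisySignMap {m n s : ℕ} (A : Matrix (Fin m) (Fin n) ℝ)
    (η : EuclideanSpace ℝ (Fin m)) (x y : sparseSphere n s) :
    hammingMetric (noisySignMap A η x.1) (noisySignMap A η y.1) =
      frequency (fun p : sparseSphere n s × sparseSphere n s => separatingSet p.1.1 p.2.1)
        (fun k => (A k, η k)) (x, y) := by
  classical
  unfold hammingMetric frequency hammingDist
  congr 3
  ext k
  have hpos : ∀ x : EuclideanSpace ℝ (Fin n),
      ((A k, η k) ∈ positiveSet x ↔ 0 < A.mulVec x.ofLp k + η k) := fun x => Iff.rfl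
  rw [Finset.mem_filter, mem_trace]
  simp only [Finset.mem_univ, true_and, separatingSet, Set.mem_symmDiff, hpos, noisySignMap, sgn]
  have h1 : (1 : ℤˣ) ≠ -1 := by decide
  by_cases hx : 0 < A.mulVec x.1.ofLp k + η k <;> by_cases hy : 0 < A.mulVec y.1.ofLp k + η k <;>
    simp [hx, hy, h1, h1.symm]

/-- The constant is `5120 = 20 · 256`, from the packing bound and from the exponent of the uniform
law. -/
lemma noisyRIPWithProb_of_le {m n s : ℕ} {ε δ : ℝ} (σ : ℝ) (hε : 0 < ε) (hε1 : ε < 1) (hδ : 0 < δ)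
    (hs : 1 ≤ s) (hsn : s < n)
    (hm : 5120 * ((δ ^ 2)⁻¹ * (Real.log (2 / ε) + s * Real.log (Real.exp 1 * n / s))) ≤ (m : ℝ)) :
    NoisyRIPWithProb.{u} m n s δ σ ε := by
  intro Ω _ P _ A η hmodel
  set K := s * Real.log (Real.exp 1 * n / s) with hK
  have hs0 : (0 : ℝ) < s := by exact_mod_cast hs
  have hs1 : (1 : ℝ) ≤ s := by exact_mod_cast hs
  have hsK : (s : ℝ) ≤ K := by
    have : 1 ≤ Real.log (Real.exp 1 * n / s) := by
      rw [Real.le_log_iff_exp_le (by have : 0 < n := by omega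
                                     positivity), le_div_iff₀ hs0]
      gcongr
    rw [hK]
    exact le_mul_of_one_le_right hs0.le this
  have hK1 : 1 ≤ K := hs1.trans hsK
  have hlog : 0 ≤ Real.log (2 / ε) := Real.log_nonneg (by rw [le_div_iff₀ hε]; linarith)
  have hmδ : 20 * (Real.log (2 / ε) + K) ≤ m * δ ^ 2 / 256 := by
    have h1 : 5120 * (Real.log (2 / ε) + K) ≤ m * δ ^ 2 := by
      have := mul_le_mul_of_nonneg_right hm (sq_nonneg δ)
      refine le_trans (le_of_eq ?_) this
      field_simp
    linarith
  have hm1 : 1 ≤ m := by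
    rcases Nat.eq_zero_or_pos m with h | h
    · rw [h] at hmδ
      norm_num at hmδ
      linarith
    · exact h
  set D : sparseSphere n s × sparseSphere n s → Set ((Fin n → ℝ) × ℝ) :=
    fun p => separatingSet p.1.1 p.2.1 with hD
  set X : Ω → Fin m → (Fin n → ℝ) × ℝ := fun ω k => (A ω k, η ω k) with hX
  set B : Set (Fin m → (Fin n → ℝ) × ℝ) :=
    {z | ∃ i, δ < |frequency D z i - (rowLaw n σ).real (D i)|} with hB
  have hlaw : HasLaw X (Measure.pi fun _ : Fin m => rowLaw n σ) P := hmodel.hasLaw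
  have hbound : (Measure.pi fun _ : Fin m => rowLaw n σ) B ≤ ENNReal.ofReal ε := by
    refine (pi_exists_lt_abs_frequency_sub_le (rowLaw n σ) (D := D) hm1 hK1 hsK hδ (by linarith)
      (fun i => measurableSet_separatingSet _ _)
      (fun N z b hb => card_traces_separatingSet_le hs hsn.le z hb)
      (fun t => measurableSet_mem_traces_separatingSet t)).trans (ENNReal.ofReal_le_ofReal ?_)
    -- The spare `3` pays for the prefactor: `8 · (ε / 2) · exp (-3) ≤ ε`.
    have h4 : Real.exp (-(m * δ ^ 2 / 256)) ≤ Real.exp (-(Real.log (2 / ε) + 3)) :=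
      Real.exp_le_exp.2 (by linarith)
    have h5 : Real.exp (-(Real.log (2 / ε) + 3)) = ε / 2 * Real.exp (-3) := by
      rw [neg_add, Real.exp_add, ← Real.log_inv, Real.exp_log (by positivity), inv_div]
    have h6 : Real.exp (-3) ≤ 1 / 4 := by
      rw [Real.exp_neg, one_div]
      refine inv_anti₀ (by norm_num) ?_
      have := Real.add_one_le_exp (3 : ℝ)
      linarith
    rw [h5] at h4
    nlinarith
  have hbad : P (X ⁻¹' B) ≤ ENNReal.ofReal ε := by
    set π := Measure.pi fun _ : Fin m => rowLaw n σ
    calc P (X ⁻¹' B) ≤ P (X ⁻¹' toMeasurable π B) :=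
          measure_mono (Set.preimage_mono (subset_toMeasurable π B))
      _ = π (toMeasurable π B) := by
          rw [← Measure.map_apply_of_aemeasurable hlaw.aemeasurable (measurableSet_toMeasurable _ _),
            hlaw.map_eq]
      _ ≤ ENNReal.ofReal ε := by rw [measure_toMeasurable]; exact hbound
  -- The good event is the complement of a measurable hull of the bad set, so measurability of the
  -- bad set itself is not needed.
  refine ⟨(toMeasurable P (X ⁻¹' B))ᶜ, (measurableSet_toMeasurable _ _).compl, ?_, ?_⟩
  · rw [measureReal_compl (measurableSet_toMeasurable _ _), probReal_univ, measureReal_def,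
      measure_toMeasurable]
    have := ENNReal.toReal_le_of_le_ofReal hε.le hbad
    linarith
  · intro ω hω x y
    have hω' : X ω ∉ B := fun h => hω (subset_toMeasurable P _ h)
    rw [hammingMetric_noisySignMap, ← rowLaw_separatingSet σ x.2.1 y.2.1]
    by_contra! h
    exact hω' ⟨(x, y), h⟩

end Main

end OneBit

theorem theorem2p5 :
    (∃ C : ℝ, 0 < C ∧ ∀ (m n s : ℕ) (ε δ σ : ℝ), 0 < ε → ε < 1 → 0 < δ → δ < 1 →
      1 ≤ s → s < n →
      C * ((δ ^ 2)⁻¹ * (Real.log (2 / ε) + s * Real.log (Real.exp 1 * n / s))) ≤ (m : ℝ) →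
      OneBit.NoisyRIPWithProb.{u} m n s δ σ ε) ∧
    (∀ κ : ℝ, 0 < κ → κ < 1 →
      ∃ C : ℝ, 0 < C ∧ ∀ (m n s : ℕ) (ε δ σ : ℝ), 0 < ε → ε < 1 → 0 < δ → δ < 1 →
      1 ≤ s → (s : ℝ) ≤ κ * n →
      C * ((δ ^ 2)⁻¹ * (Real.log (2 / ε) + s * Real.log ((n : ℝ) / s))) ≤ (m : ℝ) →
      OneBit.NoisyRIPWithProb.{u} m n s δ σ ε) := by
  refine ⟨⟨5120, by norm_num, fun m n s ε δ σ hε hε1 hδ _ hs hsn hm =>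
    OneBit.noisyRIPWithProb_of_le σ hε hε1 hδ hs hsn hm⟩, fun κ hκ hκ1 => ?_⟩
  have hl : 0 < Real.log κ⁻¹ := Real.log_pos ((one_lt_inv₀ hκ).2 hκ1)
  -- Chosen so that `log (en/s) = 1 + log (n/s) ≤ a log (n/s)`, because `log (n/s) ≥ log κ⁻¹`.
  set a := 1 + (Real.log κ⁻¹)⁻¹ with ha
  have ha1 : 1 ≤ a := by rw [ha]; have := inv_pos.2 hl; linarith
  refine ⟨5120 * a, by positivity, fun m n s ε δ σ hε hε1 hδ _ hs hsn hm => ?_⟩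
  have hs0 : (0 : ℝ) < s := by exact_mod_cast hs
  have hn0 : (0 : ℝ) < n := by
    by_contra! h
    nlinarith
  have hsn' : s < n := by
    have : (s : ℝ) < n := by nlinarith
    exact_mod_cast this
  refine OneBit.noisyRIPWithProb_of_le σ hε hε1 hδ hs hsn' (le_trans ?_ hm)
  have hlog : 0 ≤ Real.log (2 / ε) := Real.log_nonneg (by rw [le_div_iff₀ hε]; linarith)
  have hκs : Real.log κ⁻¹ ≤ Real.log (n / s) := by
    refine Real.log_le_log (by positivity) ?_
    rw [inv_eq_one_div, div_le_div_iff₀ hκ hs0]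
    linarith
  have h1 : 1 ≤ (Real.log κ⁻¹)⁻¹ * Real.log (n / s) := by
    rw [inv_mul_eq_div, le_div_iff₀ hl, one_mul]
    exact hκs
  have h2 : Real.log (Real.exp 1 * n / s) ≤ a * Real.log (n / s) := by
    rw [mul_div_assoc, Real.log_mul (by positivity) (by positivity), Real.log_exp, ha, add_mul,
      one_mul]
    linarith
  have h3 : Real.log (2 / ε) + s * Real.log (Real.exp 1 * n / s) ≤
      a * (Real.log (2 / ε) + s * Real.log (n / s)) := by
    have h4 := mul_le_mul_of_nonneg_left h2 hs0.le
    have h5 := mul_le_mul_of_nonneg_right ha1 hlog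
    linarith
  have h6 : 0 ≤ (δ ^ 2)⁻¹ := by positivity
  calc _ ≤ 5120 * ((δ ^ 2)⁻¹ * (a * (Real.log (2 / ε) + s * Real.log (n / s)))) := by gcongr
    _ = _ := by ring
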